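/- Let $M$ be a smooth (Hausdorff, finite-dimensional) manifold, let $\nabla$ be a $C^\infty$ affine connection on $M$ with torsion $T$, and let $\overline\nabla$ be the associated torsion-free connection, $\overline\nabla_XY=\nabla_XY-\tfrac12T(X,Y)$. Let $X_1,X_2$ be $C^\infty$ vector fields on $M$, let $x\in M$ and $v_x\in T_xM$, and let $\eta_1,\eta_2$ be the integral curves of $X_1$ and $X_2$, respectively, with $\eta_1(0)=\eta_2(0)=x$. Notation. For $u,v\in T_xM$ let $\mathrm{vlft}(v,u)=\frac{d}{dt}\big|_{t=0}(v+tu)\in T_vTM$ and $\mathrm{hlft}(v,u)=TV(u)-\mathrm{vlft}(v,\nabla_uV)\in T_vTM$, where $V$ is any vector field with $V(x)=v$. For a vector field $X$ on $M$ its vertical and horizontal lifts are the vector fields on $TM$ given by $X^V(v_x)=\mathrm{vlft}(v_x,X(x))$ and $X^H(v_x)=\mathrm{hlft}(v_x,X(x))$; $\overline X^H$ is the horizontal lift with respect to $\overline\nabla$. $\Phi^Z_t$ is the (local) flow of a vector field $Z$, and juxtaposition is composition, the rightmost map acting first. $\tau_\gamma^{(t,s)},\overline\tau_\gamma^{(t,s)}\colon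 T_{\gamma(s)}M\to T_{\gamma(t)}M$ are the parallel transports along $\gamma$ with respect to $\nabla$ and $\overline\nabla$. The symmetric product is $\langle X:Y\rangle=\nabla_XY+\nabla_YX$. Define, for $t$ near $0$, $$\begin{aligned} \Upsilon_1(t)&=\Phi^{X_2^V}_{-t}\Phi^{X_1^H}_{-t}\Phi^{X_2^V}_{t}\Phi^{X_1^H}_{t}\Phi^{X_1^V}_{-t}\Phi^{X_2^H}_{-t}\Phi^{X_1^V}_{t}\Phi^{X_2^H}_{t}(v_x),\\ \Upsilon_2(t)&=\Phi^{X_2^V}_{-t}\Phi^{\overline X_1^H}_{-t}\Phi^{X_2^V}_{t}\Phi^{\overline X_1^H}_{t}\Phi^{X_1^V}_{-t}\Phi^{\overline X_2^H}_{-t}\Phi^{X_1^V}_{t}\Phi^{\overline X_2^H}_{t}(v_x),\\ \Upsilon_3(t)&=\Phi^{X_2^V}_{-t}\tau_{\eta_1}^{(0,t)}\Phi^{X_2^V}_{t}\tau_{\eta_1}^{(t,0)}\Phi^{X_1^V}_{-t}\tau_{\eta_2}^{(0,t)}\Phi^{X_1^V}_{t}\tau_{\eta_2}^{(t,0)}(v_x),\\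 \Upsilon_4(t)&=\Phi^{X_2^V}_{-t}\overline\tau_{\eta_1}^{(0,t)}\Phi^{X_2^V}_{t}\overline\tau_{\eta_1}^{(t,0)}\Phi^{X_1^V}_{-t}\overline\tau_{\eta_2}^{(0,t)}\Phi^{X_1^V}_{t}\overline\tau_{\eta_2}^{(t,0)}(v_x). \end{aligned}$$ Then each $\Upsilon\in\{\Upsilon_1,\Upsilon_2,\Upsilon_3,\Upsilon_4\}$ is defined for all $t$ in a neighbourhood of $0$, $\Upsilon(0)=v_x$, $\Upsilon'(0)=0$, and $$\frac12\frac{d^2}{dt^2}\Big|_{t=0}\Upsilon(t)=\langle X_1:X_2\rangle^V(v_x).$$ Here, since $\Upsilon'(0)=0$, the second derivative at $0$ is the tangent vector in $T_{v_x}TM$ that acts on functions $f$ smooth near $v_x$ by $f\mapsto(f\circ\Upsilon)''(0)$. -/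

import Mathlib

open Set Filter Bundle
open scoped Manifold ContDiff Topology

noncomputable section

/-! ### Flows and second derivatives of curves on a manifold -/

section General

variable {E : Type*} [NormedAddCommGroup E] [NormedSpace ℝ E]
  {H : Type*} [TopologicalSpace H] {I : ModelWithCorners ℝ E H}
  {N : Type*} [TopologicalSpace N] [ChartedSpace H N]

/-- `FlowsTo Z t p q`: the integral curve of the vector field `Z` that starts at `p` at time `0`
exists up to time `t` (positive, negative or zero), where it is at `q`. -/
def FlowsTo (Z : (x : N) → TangentSpace I x) (t : ℝ) (p q : N) : Prop :=
  ∃ (γ : ℝ → N) (a b : ℝ), (0 : ℝ) ∈ Ioo a b ∧ t ∈ Ioo a b ∧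
    IsMIntegralCurveOn γ Z (Ioo a b) ∧ γ 0 = p ∧ γ t = q

/-- The time-`t` flow `Φ^Z_t` of a vector field, as a partially defined map. -/
def flow (Z : (x : N) → TangentSpace I x) (t : ℝ) : N →. N :=
  fun p ↦ ⟨∃ q, FlowsTo Z t p q, fun h ↦ h.choose⟩

/-- `HasSecondMDerivAt I c t₀ a`: the curve `c` has second derivative `a ∈ T_{c(t₀)} N` at a time
`t₀` at which its velocity vanishes. Such a second derivative is a well-defined tangent vector, the
one that acts on every function `f` which is smooth at `c t₀` by `a f = (f ∘ c)''(t₀)`. -/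
def HasSecondMDerivAt (I : ModelWithCorners ℝ E H) (c : ℝ → N) (t₀ : ℝ)
    (a : TangentSpace I (c t₀)) : Prop :=
  HasMFDerivAt 𝓘(ℝ, ℝ) I c t₀ 0 ∧
  ∀ f : N → ℝ, ContMDiffAt I 𝓘(ℝ, ℝ) ∞ f (c t₀) →
    (∀ᶠ t in 𝓝 t₀, DifferentiableAt ℝ (f ∘ c) t) ∧
    HasDerivAt (deriv (f ∘ c)) (mfderiv I 𝓘(ℝ, ℝ) f (c t₀) a : ℝ) t₀

end General

/-! ### Lifts to the tangent bundle, parallel transport, symmetric product -/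

section AffineConnection

variable {E : Type*} [NormedAddCommGroup E] [NormedSpace ℝ E]
  {M : Type*} [TopologicalSpace M] [ChartedSpace E M] [IsManifold 𝓘(ℝ, E) ∞ M]

/-- The vertical lift `vlft(v, u) = d/dt|₀ (v + t u)` of `u` to `v`, both tangent at the same
point. -/
def vlft (v : TangentBundle 𝓘(ℝ, E) M) (u : TangentSpace 𝓘(ℝ, E) v.proj) :
    TangentSpace 𝓘(ℝ, E).tangent v :=
  (mfderiv 𝓘(ℝ, ℝ) 𝓘(ℝ, E).tangent
    (fun t : ℝ ↦ (⟨v.proj, v.snd + t • u⟩ : TangentBundle 𝓘(ℝ, E) M)) 0 (1 : ℝ) : E × E)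

/-- The vertical lift `X^V` of a vector field `X`. -/
def verticalLift (X : (x : M) → TangentSpace 𝓘(ℝ, E) x) (v : TangentBundle 𝓘(ℝ, E) M) :
    TangentSpace 𝓘(ℝ, E).tangent v :=
  vlft v (X v.proj)

/-- The horizontal lift `hlft(v, u) = TV(u) - vlft(v, ∇_u V)` of `u` to `v`, both tangent at the
same point, where `V` is a vector field with value `v` there (`FiberBundle.extend` provides one
that is smooth near the point; the result does not depend on the choice). -/
def hlft (cov : CovariantDerivative 𝓘(ℝ, E) E (TangentSpace 𝓘(ℝ, E) : M → Type _))
    (v : TangentBundle 𝓘(ℝ, E) M) (u : TangentSpace 𝓘(ℝ, E) v.proj) :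
    TangentSpace 𝓘(ℝ, E).tangent v :=
  let V : (x : M) → TangentSpace 𝓘(ℝ, E) x := FiberBundle.extend E v.snd
  let TVu : TangentSpace 𝓘(ℝ, E).tangent v :=
    (mfderiv 𝓘(ℝ, E) 𝓘(ℝ, E).tangent
      (fun x : M ↦ (⟨x, V x⟩ : TangentBundle 𝓘(ℝ, E) M)) v.proj u : E × E)
  TVu - vlft v (cov V v.proj u)

/-- The horizontal lift `X^H` of a vector field `X`. -/
def horizontalLift (cov : CovariantDerivative 𝓘(ℝ, E) E (TangentSpace 𝓘(ℝ, E) : M → Type _))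
    (X : (x : M) → TangentSpace 𝓘(ℝ, E) x) (v : TangentBundle 𝓘(ℝ, E) M) :
    TangentSpace 𝓘(ℝ, E).tangent v :=
  hlft cov v (X v.proj)

/-- The covariant derivative `(∇_{γ'} Y)(t)` of a vector field `Y` along a curve `γ`. Here `Y` is
given as a curve in the tangent bundle, and `γ` is its projection to `M`. In the local frame
`e_1, …, e_n` that is constant in the trivialization of `TM` at `γ t`, it is
`∑ (Yⁱ)'(t) e_i + ∑ Yⁱ(t) ∇_{γ'(t)} e_i`; the second sum is the covariant derivative of the field
`∑ Yⁱ(t) e_i = FiberBundle.extend E (Y t).snd` with constant coefficients. -/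
def covDerivAlong (cov : CovariantDerivative 𝓘(ℝ, E) E (TangentSpace 𝓘(ℝ, E) : M → Type _))
    (Y : ℝ → TangentBundle 𝓘(ℝ, E) M) (t : ℝ) : TangentSpace 𝓘(ℝ, E) (Y t).proj :=
  let e := trivializationAt E (TangentSpace 𝓘(ℝ, E) : M → Type _) (Y t).proj
  e.symm (Y t).proj (deriv (fun s ↦ (e (Y s)).2) t) +
    cov (FiberBundle.extend E (Y t).snd) (Y t).proj
      (mfderiv 𝓘(ℝ, ℝ) 𝓘(ℝ, E) (fun s ↦ (Y s).proj) t (1 : ℝ))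

/-- `TransportsTo cov γ t₀ t p q`: the vector `q` at `γ t` is the value at time `t` of a parallel
vector field along `γ` whose value at time `t₀` is `p`. -/
def TransportsTo (cov : CovariantDerivative 𝓘(ℝ, E) E (TangentSpace 𝓘(ℝ, E) : M → Type _))
    (γ : ℝ → M) (t₀ t : ℝ) (p q : TangentBundle 𝓘(ℝ, E) M) : Prop :=
  ∃ (Y : ℝ → TangentBundle 𝓘(ℝ, E) M) (a b : ℝ), t₀ ∈ Ioo a b ∧ t ∈ Ioo a b ∧
    (∀ s ∈ Ioo a b, (Y s).proj = γ s ∧ MDifferentiableAt 𝓘(ℝ, ℝ) 𝓘(ℝ, E).tangent Y s ∧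
      covDerivAlong cov Y s = 0) ∧
    Y t₀ = p ∧ Y t = q

/-- The parallel transport `τ_γ^{(t,t₀)} : T_{γ(t₀)} M → T_{γ(t)} M` along `γ`, as a partially
defined map of the tangent bundle. -/
def parallelTransport
    (cov : CovariantDerivative 𝓘(ℝ, E) E (TangentSpace 𝓘(ℝ, E) : M → Type _))
    (γ : ℝ → M) (t t₀ : ℝ) : TangentBundle 𝓘(ℝ, E) M →. TangentBundle 𝓘(ℝ, E) M :=
  fun p ↦ ⟨∃ q, TransportsTo cov γ t₀ t p q, fun h ↦ h.choose⟩

/-- The symmetric product `⟨X : Y⟩ = ∇_X Y + ∇_Y X`; note that Mathlib writes `∇_X Y` at `x` as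
`cov Y x (X x)`. -/
def symmetricProduct
    (cov : CovariantDerivative 𝓘(ℝ, E) E (TangentSpace 𝓘(ℝ, E) : M → Type _))
    (X Y : (x : M) → TangentSpace 𝓘(ℝ, E) x) (x : M) : TangentSpace 𝓘(ℝ, E) x :=
  cov Y x (X x) + cov X x (Y x)

variable [FiniteDimensional ℝ E]

/-- The torsion-free connection `∇̄_X Y = ∇_X Y - ½ T(X, Y) = ∇_X Y + ½ T(Y, X)` with the same
geodesics as `∇`. -/
def torsionFreePart
    (cov : CovariantDerivative 𝓘(ℝ, E) E (TangentSpace 𝓘(ℝ, E) : M → Type _)) :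
    CovariantDerivative 𝓘(ℝ, E) E (TangentSpace 𝓘(ℝ, E) : M → Type _) :=
  cov.addOneForm fun x ↦ (1 / 2 : ℝ) • cov.torsion x


end AffineConnection

/-! ### The eight-fold compositions -/

section Compositions

variable {E : Type*} [NormedAddCommGroup E] [NormedSpace ℝ E]
  {M : Type*} [TopologicalSpace M] [ChartedSpace E M] [IsManifold 𝓘(ℝ, E) ∞ M]

/-- `Φ^{X₂^V}_{-t} Φ^{X₁^H}_{-t} Φ^{X₂^V}_t Φ^{X₁^H}_t Φ^{X₁^V}_{-t} Φ^{X₂^H}_{-t} Φ^{X₁^V}_t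
Φ^{X₂^H}_t (v)`, defined for those `t` for which all the flows are. The rightmost flow acts
first. -/
def upsilonFlow
    (cov : CovariantDerivative 𝓘(ℝ, E) E (TangentSpace 𝓘(ℝ, E) : M → Type _))
    (X₁ X₂ : (x : M) → TangentSpace 𝓘(ℝ, E) x) (v : TangentBundle 𝓘(ℝ, E) M) :
    ℝ →. TangentBundle 𝓘(ℝ, E) M := fun t ↦
  flow (horizontalLift cov X₂) t v >>= flow (verticalLift X₁) t >>=
    flow (horizontalLift cov X₂) (-t) >>= flow (verticalLift X₁) (-t) >>=
    flow (horizontalLift cov X₁) t >>= flow (verticalLift X₂) t >>=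
    flow (horizontalLift cov X₁) (-t) >>= flow (verticalLift X₂) (-t)

/-- `Φ^{X₂^V}_{-t} τ_{η₁}^{(0,t)} Φ^{X₂^V}_t τ_{η₁}^{(t,0)} Φ^{X₁^V}_{-t} τ_{η₂}^{(0,t)} Φ^{X₁^V}_t
τ_{η₂}^{(t,0)} (v)`, defined for those `t` for which all the maps are. The rightmost map acts
first. -/
def upsilonTransport
    (cov : CovariantDerivative 𝓘(ℝ, E) E (TangentSpace 𝓘(ℝ, E) : M → Type _))
    (X₁ X₂ : (x : M) → TangentSpace 𝓘(ℝ, E) x) (η₁ η₂ : ℝ → M) (v : TangentBundle 𝓘(ℝ, E) M) :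
    ℝ →. TangentBundle 𝓘(ℝ, E) M := fun t ↦
  parallelTransport cov η₂ t 0 v >>= flow (verticalLift X₁) t >>=
    parallelTransport cov η₂ 0 t >>= flow (verticalLift X₁) (-t) >>=
    parallelTransport cov η₁ t 0 >>= flow (verticalLift X₂) t >>=
    parallelTransport cov η₁ 0 t >>= flow (verticalLift X₂) (-t)

end Compositions

end

/-!
The four compositions are computed exactly for small `t`; no expansion of flows in powers of `t` is
needed.

The flow of a vertical lift `X^V` translates each tangent space, `p ↦ p + t X`
(`flow_verticalLift`). The flow of a horizontal lift `X^H` over an integral curve `η` of `X` is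
parallel transport along `η` (`IsParallelFrame.flow_horizontalLift_eq`,
`IsParallelFrame.parallelTransport_eq`), so that flows and parallel transports give the same curves.
In the trivialization of `TM` at `x` parallel transport is the fundamental solution `P` of the
linear differential equation `w' = -Γ(X, w)`, with inverse `Q`. Going out along the integral curve `η` of
`X`, translating by `t Y`, coming back and translating by `-t Y` therefore maps `w ∈ T_x M` to
`w + t (g(t) - g(0))`, where `g(t) = Q(t) Y(η(t))` is the field `Y` pulled back to `x` by parallel
transport (`bind_loop_eq`). Two such loops give `Υ(t) = v + t (G(t) - G(0))`, where `G` is the sum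
of the two functions `g`; this curve remains in `T_x M` (`exists_eventually_upsilon_eq`).

The derivative of `g` is the pulled-back covariant derivative `∇_X Y`
(`IsParallelFrame.hasDerivAt_inv_fibreCoord`), so that `G'(0) = ∇_{X₂} X₁ + ∇_{X₁} X₂ = ⟨X₁ : X₂⟩`,
and `G'` is continuous at `0`. Hence `Υ'(0) = 0` and `Υ''(0) = 2 G'(0)` as a vertical vector
(`hasSecondMDerivAt_of_eventuallyEq`). The connection `∇̄` is smooth too, and has the same symmetric
product because the torsion is antisymmetric (`symmetricProduct_torsionFreePart`).

Tangent vectors to `TM` are compared through their images under the projection and under the fibre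
coordinate of a trivialization (`tangent_tangentBundle_ext`). In these terms the lifts and the
covariant derivative take their classical coordinate form (`vlft_fibreCoord`, `hlft_fibreCoord`,
`fibreCoord_cov`).
-/

noncomputable section

/-! ### Velocities of curves -/

section Velocity

variable {E : Type*} [NormedAddCommGroup E] [NormedSpace ℝ E]
  {H : Type*} [TopologicalSpace H] {I : ModelWithCorners ℝ E H}
  {N : Type*} [TopologicalSpace N] [ChartedSpace H N]
  {E' : Type*} [NormedAddCommGroup E'] [NormedSpace ℝ E']
  {H' : Type*} [TopologicalSpace H'] {I' : ModelWithCorners ℝ E' H'}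
  {N' : Type*} [TopologicalSpace N'] [ChartedSpace H' N']

/-- `HasVelocityAt I c s z`: the curve `c` is differentiable at time `s`, with velocity `z`. -/
def HasVelocityAt (I : ModelWithCorners ℝ E H) (c : ℝ → N) (s : ℝ) (z : TangentSpace I (c s)) :
    Prop :=
  HasMFDerivAt 𝓘(ℝ, ℝ) I c s ((1 : ℝ →L[ℝ] ℝ).smulRight z)

lemma HasVelocityAt.mfderiv_one {c : ℝ → N} {s : ℝ} {z : TangentSpace I (c s)}
    (h : HasVelocityAt I c s z) : mfderiv 𝓘(ℝ, ℝ) I c s (1 : ℝ) = z := by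
  have h' := congr($(HasMFDerivAt.mfderiv h) (1 : ℝ))
  exact h'.trans (one_smul ℝ z)

lemma hasVelocityAt_of_mfderiv_one {c : ℝ → N} {s : ℝ} {z : TangentSpace I (c s)}
    (hc : MDifferentiableAt 𝓘(ℝ, ℝ) I c s) (h : mfderiv 𝓘(ℝ, ℝ) I c s (1 : ℝ) = z) :
    HasVelocityAt I c s z := by
  have hz : mfderiv 𝓘(ℝ, ℝ) I c s = (1 : ℝ →L[ℝ] ℝ).smulRight z := by
    refine ContinuousLinearMap.ext fun a ↦ ?_
    have h1 := map_smul (mfderiv 𝓘(ℝ, ℝ) I c s) (show ℝ from a)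
      (show TangentSpace 𝓘(ℝ, ℝ) s from (1 : ℝ))
    have h2 : (show ℝ from a) • (show TangentSpace 𝓘(ℝ, ℝ) s from (1 : ℝ)) = a :=
      mul_one (show ℝ from a)
    rw [h2] at h1
    rw [h1]
    exact congr((show ℝ from a) • $h)
  have := hc.hasMFDerivAt
  rw [hz] at this
  exact this

lemma HasVelocityAt.comp {f : N → N'} {c : ℝ → N} {s : ℝ} {z : TangentSpace I (c s)}
    (hf : MDifferentiableAt I I' f (c s)) (h : HasVelocityAt I c s z) :
    HasVelocityAt I' (fun t ↦ f (c t)) s (mfderiv I I' f (c s) z) := by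
  have h' := hf.hasMFDerivAt.comp s h
  refine hasVelocityAt_of_mfderiv_one h'.mdifferentiableAt ?_
  rw [← h.mfderiv_one]
  exact congr($(mfderiv_comp s hf (HasMFDerivAt.mdifferentiableAt h)) (1 : ℝ))

lemma HasVelocityAt.mdifferentiableAt {c : ℝ → N} {s : ℝ} {z : TangentSpace I (c s)}
    (h : HasVelocityAt I c s z) : MDifferentiableAt 𝓘(ℝ, ℝ) I c s :=
  HasMFDerivAt.mdifferentiableAt h

lemma hasVelocityAt_iff_hasDerivAt {c : ℝ → E} {s : ℝ} {z : E} :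
    HasVelocityAt 𝓘(ℝ, E) c s z ↔ HasDerivAt c z s := by
  constructor
  · intro h
    have h' := h.mdifferentiableAt.differentiableAt.hasDerivAt
    have h2 := HasVelocityAt.mfderiv_one h
    rw [mfderiv_eq_fderiv] at h2
    change HasDerivAt c (fderiv ℝ c s 1) s at h'
    exact h2 ▸ h'
  · intro h
    exact hasVelocityAt_of_mfderiv_one h.differentiableAt.mdifferentiableAt
      (by rw [mfderiv_eq_fderiv]; exact h.deriv)

lemma mvfderiv_congr_of_eventuallyEq {f g : N → E'} {x : N} (h : f =ᶠ[𝓝 x] g) :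
    mvfderiv I f x = mvfderiv I g x :=
  ContinuousLinearMap.ext fun u ↦ congr($(h.mfderiv_eq (I := I) (I' := 𝓘(ℝ, E'))) u)

end Velocity

/-! ### Coordinates on the tangent bundle -/

section Coordinates

variable {E : Type*} [NormedAddCommGroup E] [NormedSpace ℝ E]
  {M : Type*} [TopologicalSpace M] [ChartedSpace E M] [IsManifold 𝓘(ℝ, E) ∞ M]

/-- The fibre coordinate of a tangent vector in the preferred trivialization of `TM` at `x₀`. It is
only meaningful over the base set of that trivialization. -/
def fibreCoord (x₀ : M) (p : TangentBundle 𝓘(ℝ, E) M) : E :=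
  (trivializationAt E (TangentSpace 𝓘(ℝ, E) : M → Type _) x₀ p).2

/-- The base set of the preferred trivialization of `TM` at `x₀`. -/
abbrev frameDomain (E : Type*) [NormedAddCommGroup E] [NormedSpace ℝ E]
    {M : Type*} [TopologicalSpace M] [ChartedSpace E M] [IsManifold 𝓘(ℝ, E) ∞ M] (x₀ : M) : Set M :=
  (trivializationAt E (TangentSpace 𝓘(ℝ, E) : M → Type _) x₀).baseSet

/-- The vector field whose fibre coordinate is constant, equal to `w`, over the base set of the
preferred trivialization at `x₀`. -/
def constField (x₀ : M) (w : E) (x : M) : TangentSpace 𝓘(ℝ, E) x :=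
  (trivializationAt E (TangentSpace 𝓘(ℝ, E) : M → Type _) x₀).symmL ℝ x w

lemma isOpen_frameDomain (x₀ : M) : IsOpen (frameDomain E x₀) :=
  (trivializationAt E (TangentSpace 𝓘(ℝ, E) : M → Type _) x₀).open_baseSet

lemma mem_frameDomain (x₀ : M) : x₀ ∈ frameDomain E x₀ :=
  FiberBundle.mem_baseSet_trivializationAt' x₀

lemma mem_trivializationAt_source {x₀ : M} {p : TangentBundle 𝓘(ℝ, E) M}
    (hp : p.proj ∈ frameDomain E x₀) :
    p ∈ (trivializationAt E (TangentSpace 𝓘(ℝ, E) : M → Type _) x₀).source :=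
  (Trivialization.mem_source _).2 hp

lemma fibreCoord_constField {x₀ x : M} (hx : x ∈ frameDomain E x₀) (w : E) :
    fibreCoord x₀ ⟨x, constField x₀ w x⟩ = w := by
  unfold fibreCoord constField
  rw [Trivialization.symmL_apply _ hx, Trivialization.apply_mk_symm _ hx]

lemma constField_fibreCoord {x₀ x : M} (hx : x ∈ frameDomain E x₀) (u : TangentSpace 𝓘(ℝ, E) x) :
    constField x₀ (fibreCoord x₀ ⟨x, u⟩) x = u := by
  unfold fibreCoord constField
  rw [Trivialization.symmL_apply _ hx, Trivialization.symm_apply_apply_mk _ hx]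

lemma fibreCoord_eq_linearMapAt {x₀ x : M} (hx : x ∈ frameDomain E x₀)
    (u : TangentSpace 𝓘(ℝ, E) x) :
    fibreCoord x₀ ⟨x, u⟩ =
      (trivializationAt E (TangentSpace 𝓘(ℝ, E) : M → Type _) x₀).continuousLinearMapAt ℝ x u := by
  rw [Trivialization.continuousLinearMapAt_apply, Trivialization.linearMapAt_apply, if_pos hx]
  rfl

lemma fibreCoord_add {x₀ x : M} (hx : x ∈ frameDomain E x₀) (u v : TangentSpace 𝓘(ℝ, E) x) :
    fibreCoord x₀ ⟨x, u + v⟩ = fibreCoord x₀ ⟨x, u⟩ + fibreCoord x₀ ⟨x, v⟩ := by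
  simp only [fibreCoord_eq_linearMapAt hx, map_add]

lemma fibreCoord_smul {x₀ x : M} (hx : x ∈ frameDomain E x₀) (a : ℝ) (u : TangentSpace 𝓘(ℝ, E) x) :
    fibreCoord x₀ ⟨x, a • u⟩ = a • fibreCoord x₀ ⟨x, u⟩ := by
  simp only [fibreCoord_eq_linearMapAt hx, map_smul]

lemma fibreCoord_self {x : M} (u : TangentSpace 𝓘(ℝ, E) x) : fibreCoord x ⟨x, u⟩ = u := by
  unfold fibreCoord
  rw [TangentBundle.trivializationAt_apply]
  have := tangentCoordChange_self (I := 𝓘(ℝ, E)) (x := x) (z := x) (v := u)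
    (mem_extChartAt_source x)
  simpa [tangentCoordChange_def] using this

lemma constField_self {x : M} (w : E) : constField x w x = w := by
  have := constField_fibreCoord (mem_frameDomain x) (w : TangentSpace 𝓘(ℝ, E) x)
  rwa [show fibreCoord x ⟨x, w⟩ = w from fibreCoord_self (w : TangentSpace 𝓘(ℝ, E) x)] at this

lemma constField_add (x₀ : M) (w w' : E) :
    constField x₀ (w + w') = constField x₀ w + constField x₀ w' :=
  funext fun _ ↦ map_add _ w w'

lemma constField_smul (x₀ : M) (a : ℝ) (w : E) :
    constField x₀ (a • w) = a • constField x₀ w :=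
  funext fun _ ↦ map_smul _ a w

lemma tangentBundle_ext {x₀ : M} {p q : TangentBundle 𝓘(ℝ, E) M} (hp : p.proj ∈ frameDomain E x₀)
    (h : p.proj = q.proj) (h' : fibreCoord x₀ p = fibreCoord x₀ q) : p = q := by
  obtain ⟨x, u⟩ := p
  obtain ⟨y, v⟩ := q
  obtain rfl : x = y := h
  congr 1
  rw [← constField_fibreCoord hp u, h', constField_fibreCoord hp v]

lemma extend_eq_constField {x y : M} (hy : y ∈ frameDomain E x) (u : TangentSpace 𝓘(ℝ, E) x) :
    FiberBundle.extend E u y = constField (E := E) x u y := by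
  have h := fibreCoord_self u
  unfold fibreCoord at h
  unfold constField FiberBundle.extend
  exact (congrArg _ h).trans (Trivialization.symmL_apply _ hy (u : E)).symm

lemma contMDiffOn_constField (x₀ : M) (w : E) :
    ContMDiffOn 𝓘(ℝ, E) 𝓘(ℝ, E).tangent ∞
      (fun x ↦ (⟨x, constField x₀ w x⟩ : TangentBundle 𝓘(ℝ, E) M)) (frameDomain E x₀) := by
  intro x hx
  rw [(trivializationAt E (TangentSpace 𝓘(ℝ, E) : M → Type _) x₀).contMDiffWithinAt_section _ hx]
  exact (contMDiffOn_const (c := w)).congr (fun y hy ↦ fibreCoord_constField hy w) x hx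

lemma mdifferentiableAt_constField {x₀ x : M} (hx : x ∈ frameDomain E x₀) (w : E) :
    MDifferentiableAt 𝓘(ℝ, E) 𝓘(ℝ, E).tangent
      (fun x ↦ (⟨x, constField x₀ w x⟩ : TangentBundle 𝓘(ℝ, E) M)) x :=
  ((contMDiffOn_constField x₀ w).contMDiffAt
    ((isOpen_frameDomain x₀).mem_nhds hx)).mdifferentiableAt (by simp)

lemma contMDiffAt_fibreCoord {x₀ : M} {p : TangentBundle 𝓘(ℝ, E) M}
    (hp : p.proj ∈ frameDomain E x₀) :
    ContMDiffAt 𝓘(ℝ, E).tangent 𝓘(ℝ, E) ∞ (fibreCoord x₀) p := by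
  have h := (trivializationAt E (TangentSpace 𝓘(ℝ, E) : M → Type _) x₀).contMDiffOn
    (IB := 𝓘(ℝ, E)) (n := ∞)
  have h' := h.contMDiffAt
    ((OpenPartialHomeomorph.open_source _).mem_nhds (mem_trivializationAt_source hp))
  exact h'.snd

lemma mdifferentiableAt_fibreCoord {x₀ : M} {p : TangentBundle 𝓘(ℝ, E) M}
    (hp : p.proj ∈ frameDomain E x₀) :
    MDifferentiableAt 𝓘(ℝ, E).tangent 𝓘(ℝ, E) (fibreCoord x₀) p :=
  (contMDiffAt_fibreCoord hp).mdifferentiableAt (by simp)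

lemma mdifferentiableAt_tangentBundle_proj (p : TangentBundle 𝓘(ℝ, E) M) :
    MDifferentiableAt 𝓘(ℝ, E).tangent 𝓘(ℝ, E) (TotalSpace.proj : TangentBundle 𝓘(ℝ, E) M → M) p :=
  mdifferentiableAt_proj _

/-- A tangent vector to `TM` is determined by its images under the projection and the fibre
coordinate. -/
lemma tangent_tangentBundle_ext {x₀ : M} {p : TangentBundle 𝓘(ℝ, E) M}
    (hp : p.proj ∈ frameDomain E x₀) {z z' : TangentSpace 𝓘(ℝ, E).tangent p}
    (h : mfderiv 𝓘(ℝ, E).tangent 𝓘(ℝ, E) (TotalSpace.proj : TangentBundle 𝓘(ℝ, E) M → M) p z =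
      mfderiv 𝓘(ℝ, E).tangent 𝓘(ℝ, E) (TotalSpace.proj : TangentBundle 𝓘(ℝ, E) M → M) p z')
    (h' : mvfderiv 𝓘(ℝ, E).tangent (fibreCoord x₀) p z =
      mvfderiv 𝓘(ℝ, E).tangent (fibreCoord x₀) p z') : z = z' := by
  set e := trivializationAt E (TangentSpace 𝓘(ℝ, E) : M → Type _) x₀ with he
  have hps := mem_trivializationAt_source hp
  have hinj := (Trivialization.mdifferentiable (I := 𝓘(ℝ, E))
    (TangentSpace 𝓘(ℝ, E) : M → Type _) e).mfderiv_injective hps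
  apply hinj
  have key : mfderiv 𝓘(ℝ, E).tangent (𝓘(ℝ, E).prod 𝓘(ℝ, E)) e.toOpenPartialHomeomorph p =
      (mfderiv 𝓘(ℝ, E).tangent 𝓘(ℝ, E) (TotalSpace.proj : TangentBundle 𝓘(ℝ, E) M → M) p).prod
        (mvfderiv 𝓘(ℝ, E).tangent (fibreCoord x₀) p) := by
    have := (mdifferentiableAt_tangentBundle_proj p).hasMFDerivAt.prodMk
      (mdifferentiableAt_fibreCoord hp).hasMFDerivAt
    refine (this.congr_of_eventuallyEq ?_).mfderiv
    filter_upwards [e.open_source.mem_nhds hps] with q hq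
    exact Prod.ext (Trivialization.coe_fst _ hq) rfl
  -- The derivative in the goal is that of `key` only up to unfolding.
  erw [key]
  exact Prod.ext h h'

lemma HasVelocityAt.fibreCoord {x₀ : M} {Y : ℝ → TangentBundle 𝓘(ℝ, E) M} {s : ℝ}
    (hp : (Y s).proj ∈ frameDomain E x₀) {z : TangentSpace 𝓘(ℝ, E).tangent (Y s)}
    (h : HasVelocityAt 𝓘(ℝ, E).tangent Y s z) :
    HasDerivAt (fun t ↦ fibreCoord x₀ (Y t))
      (mvfderiv 𝓘(ℝ, E).tangent (_root_.fibreCoord x₀) (Y s) z) s :=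
  hasVelocityAt_iff_hasDerivAt.1 (h.comp (mdifferentiableAt_fibreCoord hp))

/-- A curve in `TM` has velocity `z` as soon as this holds in the base and in the fibre
coordinate. -/
lemma hasVelocityAt_tangentBundle {x₀ : M} {Y : ℝ → TangentBundle 𝓘(ℝ, E) M} {s : ℝ}
    (hp : (Y s).proj ∈ frameDomain E x₀) {z : TangentSpace 𝓘(ℝ, E).tangent (Y s)}
    (h : HasVelocityAt 𝓘(ℝ, E) (fun t ↦ (Y t).proj) s
      (mfderiv 𝓘(ℝ, E).tangent 𝓘(ℝ, E) (TotalSpace.proj : TangentBundle 𝓘(ℝ, E) M → M) (Y s) z))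
    (h' : HasDerivAt (fun t ↦ fibreCoord x₀ (Y t))
      (mvfderiv 𝓘(ℝ, E).tangent (fibreCoord x₀) (Y s) z) s) :
    HasVelocityAt 𝓘(ℝ, E).tangent Y s z := by
  have hY : MDifferentiableAt 𝓘(ℝ, ℝ) 𝓘(ℝ, E).tangent Y s := by
    rw [(trivializationAt E (TangentSpace 𝓘(ℝ, E) : M → Type _) x₀).mdifferentiableAt_totalSpace_iff
      _ _ (mem_trivializationAt_source hp)]
    exact ⟨h.mdifferentiableAt, h'.differentiableAt.mdifferentiableAt⟩
  have hY' := hasVelocityAt_of_mfderiv_one hY rfl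
  refine hasVelocityAt_of_mfderiv_one hY (tangent_tangentBundle_ext hp ?_ ?_)
  · rw [← (hY'.comp (mdifferentiableAt_tangentBundle_proj (Y s))).mfderiv_one, h.mfderiv_one]
  · exact (hY'.fibreCoord hp).unique h'

/-! ### Lifts in coordinates -/

/-- The curve `t ↦ v + t u` in a tangent space is differentiable as a curve in `TM`. -/
lemma mdifferentiableAt_vlft_line (p : TangentBundle 𝓘(ℝ, E) M) (u : TangentSpace 𝓘(ℝ, E) p.proj)
    (s : ℝ) :
    MDifferentiableAt 𝓘(ℝ, ℝ) 𝓘(ℝ, E).tangent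
      (fun t : ℝ ↦ (⟨p.proj, p.snd + t • u⟩ : TangentBundle 𝓘(ℝ, E) M)) s := by
  rw [(trivializationAt E (TangentSpace 𝓘(ℝ, E) : M → Type _) p.proj).mdifferentiableAt_totalSpace_iff
      _ _ (mem_trivializationAt_source (mem_frameDomain _))]
  refine ⟨mdifferentiableAt_const, DifferentiableAt.mdifferentiableAt ?_⟩
  have h : (fun t : ℝ ↦ fibreCoord p.proj (⟨p.proj, p.snd + t • u⟩ : TangentBundle 𝓘(ℝ, E) M)) =
      fun t : ℝ ↦ fibreCoord p.proj p + t • fibreCoord p.proj ⟨p.proj, u⟩ := by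
    funext t
    rw [fibreCoord_add (mem_frameDomain _), fibreCoord_smul (mem_frameDomain _)]
  change DifferentiableAt ℝ (fun t : ℝ ↦ fibreCoord p.proj
    (⟨p.proj, p.snd + t • u⟩ : TangentBundle 𝓘(ℝ, E) M)) s
  rw [h]
  fun_prop

lemma hasVelocityAt_vlft_line (p : TangentBundle 𝓘(ℝ, E) M) (u : TangentSpace 𝓘(ℝ, E) p.proj) :
    HasVelocityAt 𝓘(ℝ, E).tangent
      (fun t : ℝ ↦ (⟨p.proj, p.snd + t • u⟩ : TangentBundle 𝓘(ℝ, E) M)) 0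
      (mfderiv 𝓘(ℝ, ℝ) 𝓘(ℝ, E).tangent
        (fun t : ℝ ↦ (⟨p.proj, p.snd + t • u⟩ : TangentBundle 𝓘(ℝ, E) M)) 0 (1 : ℝ)) :=
  hasVelocityAt_of_mfderiv_one (mdifferentiableAt_vlft_line p u 0) rfl

/-- The derivative of `f` along the vertical lift is the velocity of `t ↦ f (p + t u)`. -/
lemma mfderiv_vlft {F : Type*} [NormedAddCommGroup F] [NormedSpace ℝ F] {H : Type*}
    [TopologicalSpace H] {I : ModelWithCorners ℝ F H} {N : Type*} [TopologicalSpace N]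
    [ChartedSpace H N] {f : TangentBundle 𝓘(ℝ, E) M → N} {p : TangentBundle 𝓘(ℝ, E) M}
    (hf : MDifferentiableAt 𝓘(ℝ, E).tangent I f p) (u : TangentSpace 𝓘(ℝ, E) p.proj)
    {z : F}
    (h : HasVelocityAt I (fun t : ℝ ↦ f ⟨p.proj, p.snd + t • u⟩) 0 z) :
    (mfderiv 𝓘(ℝ, E).tangent I f p (vlft p u) : F) = z := by
  have hp : (⟨p.proj, p.snd + (0 : ℝ) • u⟩ : TangentBundle 𝓘(ℝ, E) M) = p := by
    rw [zero_smul, add_zero]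
  have hf' : MDifferentiableAt 𝓘(ℝ, E).tangent I f ⟨p.proj, p.snd + (0 : ℝ) • u⟩ := by rwa [hp]
  have h1 := ((hasVelocityAt_vlft_line p u).comp hf').mfderiv_one
  rw [h.mfderiv_one] at h1
  rw [h1]
  unfold vlft
  congr 1
  rw [hp]

lemma vlft_proj (p : TangentBundle 𝓘(ℝ, E) M) (u : TangentSpace 𝓘(ℝ, E) p.proj) :
    mfderiv 𝓘(ℝ, E).tangent 𝓘(ℝ, E) (TotalSpace.proj : TangentBundle 𝓘(ℝ, E) M → M) p (vlft p u)
      = 0 := by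
  refine mfderiv_vlft (mdifferentiableAt_tangentBundle_proj p) u ?_
  refine hasVelocityAt_of_mfderiv_one mdifferentiableAt_const ?_
  rw [mfderiv_const]
  rfl

lemma vlft_fibreCoord {x₀ : M} {p : TangentBundle 𝓘(ℝ, E) M} (hp : p.proj ∈ frameDomain E x₀)
    (u : TangentSpace 𝓘(ℝ, E) p.proj) :
    mvfderiv 𝓘(ℝ, E).tangent (fibreCoord x₀) p (vlft p u) =
      fibreCoord x₀ ⟨p.proj, u⟩ := by
  refine mfderiv_vlft (mdifferentiableAt_fibreCoord hp) u (hasVelocityAt_iff_hasDerivAt.2 ?_)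
  have h : (fun t : ℝ ↦ fibreCoord x₀ (⟨p.proj, p.snd + t • u⟩ : TangentBundle 𝓘(ℝ, E) M)) =
      fun t : ℝ ↦ fibreCoord x₀ p + t • fibreCoord x₀ ⟨p.proj, u⟩ := by
    funext t
    rw [fibreCoord_add hp, fibreCoord_smul hp]
  rw [h]
  simpa using ((hasDerivAt_id (0 : ℝ)).smul_const (fibreCoord x₀ ⟨p.proj, u⟩)).const_add
    (fibreCoord x₀ p)

lemma smul_vlft (p : TangentBundle 𝓘(ℝ, E) M) (a : ℝ) (u : TangentSpace 𝓘(ℝ, E) p.proj) :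
    a • vlft p u = vlft p (a • u) := by
  refine tangent_tangentBundle_ext (mem_frameDomain p.proj) ?_ ?_
  · rw [map_smul, vlft_proj, vlft_proj, smul_zero]
  · rw [map_smul, vlft_fibreCoord (mem_frameDomain p.proj),
      vlft_fibreCoord (mem_frameDomain p.proj), fibreCoord_smul (mem_frameDomain p.proj)]

section Connection

variable (cov : CovariantDerivative 𝓘(ℝ, E) E (TangentSpace 𝓘(ℝ, E) : M → Type _))

lemma mdifferentiableAt_fibreCoord_section {x₀ x : M} (hx : x ∈ frameDomain E x₀)
    {V : (x : M) → TangentSpace 𝓘(ℝ, E) x}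
    (hV : MDifferentiableAt 𝓘(ℝ, E) 𝓘(ℝ, E).tangent
      (fun x ↦ (⟨x, V x⟩ : TangentBundle 𝓘(ℝ, E) M)) x) :
    MDifferentiableAt 𝓘(ℝ, E) 𝓘(ℝ, E) (fun y ↦ fibreCoord x₀ ⟨y, V y⟩) x :=
  MDifferentiableAt.comp (g := fibreCoord x₀)
    (f := fun y ↦ (⟨y, V y⟩ : TangentBundle 𝓘(ℝ, E) M)) x (mdifferentiableAt_fibreCoord hx) hV

/-- The difference between a covariant derivative and the derivative of the fibre coordinate is
tensorial: the two Leibniz rules have the same derivative term. -/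
lemma tensorialAt_cov_sub {x₀ x : M} (hx : x ∈ frameDomain E x₀) (u : TangentSpace 𝓘(ℝ, E) x) :
    TensorialAt 𝓘(ℝ, E) E (fun V : (x : M) → TangentSpace 𝓘(ℝ, E) x ↦
      fibreCoord x₀ ⟨x, cov V x u⟩ -
        mvfderiv 𝓘(ℝ, E) (fun y ↦ fibreCoord x₀ ⟨y, V y⟩) x u) x where
  smul {f V} hf hV := by
    have h1 : cov (f • V) x u = f x • cov V x u + (mvfderiv 𝓘(ℝ, E) f x u) • V x := by
      rw [cov.isCovariantDerivativeOnUniv.leibniz hV hf]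
      rfl
    have h2 : mvfderiv 𝓘(ℝ, E) (fun y ↦ fibreCoord x₀ ⟨y, (f • V) y⟩) x u =
        f x • mvfderiv 𝓘(ℝ, E) (fun y ↦ fibreCoord x₀ ⟨y, V y⟩) x u +
          (mvfderiv 𝓘(ℝ, E) f x u) • fibreCoord x₀ ⟨x, V x⟩ := by
      have h3 : (fun y ↦ fibreCoord x₀ ⟨y, (f • V) y⟩) =ᶠ[𝓝 x]
          f • fun y ↦ fibreCoord x₀ ⟨y, V y⟩ := by
        filter_upwards [(isOpen_frameDomain x₀).mem_nhds hx] with y hy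
        exact fibreCoord_smul hy _ _
      rw [mvfderiv_congr_of_eventuallyEq h3,
        mvfderiv_smul hf (mdifferentiableAt_fibreCoord_section hx hV)]
      rfl
    rw [h1, h2, fibreCoord_add hx, fibreCoord_smul hx, fibreCoord_smul hx]
    module
  add {V W} hV hW := by
    have h1 : cov (V + W) x u = cov V x u + cov W x u := by
      rw [cov.isCovariantDerivativeOnUniv.add hV hW]
      rfl
    have h2 : mvfderiv 𝓘(ℝ, E) (fun y ↦ fibreCoord x₀ ⟨y, (V + W) y⟩) x u =
        mvfderiv 𝓘(ℝ, E) (fun y ↦ fibreCoord x₀ ⟨y, V y⟩) x u +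
          mvfderiv 𝓘(ℝ, E) (fun y ↦ fibreCoord x₀ ⟨y, W y⟩) x u := by
      have h3 : (fun y ↦ fibreCoord x₀ ⟨y, (V + W) y⟩) =ᶠ[𝓝 x]
          (fun y ↦ fibreCoord x₀ ⟨y, V y⟩) + fun y ↦ fibreCoord x₀ ⟨y, W y⟩ := by
        filter_upwards [(isOpen_frameDomain x₀).mem_nhds hx] with y hy
        exact fibreCoord_add hy _ _
      rw [mvfderiv_congr_of_eventuallyEq h3,
        mvfderiv_add (mdifferentiableAt_fibreCoord_section hx hV)
          (mdifferentiableAt_fibreCoord_section hx hW)]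
      rfl
    rw [h1, h2, fibreCoord_add hx]
    module

/-- The coordinate formula `∇_u V = ∂_u V + Γ(u, V)` in the trivialization at `x₀`, with the
Christoffel term written as the covariant derivative of the field that has constant fibre coordinate
and agrees with `V` at `x`. Both sides differ by a tensorial expression in `V`, so that `V` may be
replaced by this constant field, for which the derivative of the fibre coordinate vanishes. -/
lemma fibreCoord_cov [FiniteDimensional ℝ E] {x₀ x : M} (hx : x ∈ frameDomain E x₀)
    {V : (x : M) → TangentSpace 𝓘(ℝ, E) x}
    (hV : MDifferentiableAt 𝓘(ℝ, E) 𝓘(ℝ, E).tangent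
      (fun x ↦ (⟨x, V x⟩ : TangentBundle 𝓘(ℝ, E) M)) x) (u : TangentSpace 𝓘(ℝ, E) x) :
    fibreCoord x₀ ⟨x, cov V x u⟩ =
      mvfderiv 𝓘(ℝ, E) (fun y ↦ fibreCoord x₀ ⟨y, V y⟩) x u +
        fibreCoord x₀ ⟨x, cov (constField x₀ (fibreCoord x₀ ⟨x, V x⟩)) x u⟩ := by
  have h := (tensorialAt_cov_sub cov hx u).pointwise hV
    (mdifferentiableAt_constField hx (fibreCoord x₀ ⟨x, V x⟩)) (constField_fibreCoord hx _).symm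
  have h3 : (fun y ↦ fibreCoord x₀ ⟨y, constField x₀ (fibreCoord x₀ ⟨x, V x⟩) y⟩) =ᶠ[𝓝 x]
      fun _ ↦ fibreCoord x₀ ⟨x, V x⟩ := by
    filter_upwards [(isOpen_frameDomain x₀).mem_nhds hx] with y hy
    exact fibreCoord_constField hy _
  have h4 : mvfderiv 𝓘(ℝ, E)
      (fun y ↦ fibreCoord x₀ ⟨y, constField x₀ (fibreCoord x₀ ⟨x, V x⟩) y⟩) x u = 0 := by
    rw [mvfderiv_congr_of_eventuallyEq h3, mvfderiv_const]
    rfl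
  simp only [h4, sub_zero] at h
  rw [← h]
  abel

/-- The image of `u` under the derivative of a section `V` with value `p` projects to `u`. This
image is called `z`, with its type given at `p` rather than at `V p.proj`, since the two points are only
propositionally equal. -/
lemma mfderiv_section_proj {p : TangentBundle 𝓘(ℝ, E) M} {V : (x : M) → TangentSpace 𝓘(ℝ, E) x}
    (hVp : V p.proj = p.snd)
    (hV : MDifferentiableAt 𝓘(ℝ, E) 𝓘(ℝ, E).tangent
      (fun x ↦ (⟨x, V x⟩ : TangentBundle 𝓘(ℝ, E) M)) p.proj) (u : TangentSpace 𝓘(ℝ, E) p.proj)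
    {z : TangentSpace 𝓘(ℝ, E).tangent p}
    (hz : z = (mfderiv 𝓘(ℝ, E) 𝓘(ℝ, E).tangent
      (fun x ↦ (⟨x, V x⟩ : TangentBundle 𝓘(ℝ, E) M)) p.proj u : E × E)) :
    mfderiv 𝓘(ℝ, E).tangent 𝓘(ℝ, E) (TotalSpace.proj : TangentBundle 𝓘(ℝ, E) M → M) p z = u := by
  obtain ⟨x, w⟩ := p
  obtain rfl : V x = w := hVp
  have h := mfderiv_comp x (mdifferentiableAt_tangentBundle_proj
    (⟨x, V x⟩ : TangentBundle 𝓘(ℝ, E) M)) hV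
  have h2 : (TotalSpace.proj : TangentBundle 𝓘(ℝ, E) M → M) ∘
    (fun x : M ↦ (⟨x, V x⟩ : TangentBundle 𝓘(ℝ, E) M)) = id := rfl
  rw [h2, mfderiv_id] at h
  rw [hz]
  exact (congr($h u)).symm

lemma mfderiv_section_fibreCoord {x₀ : M} {p : TangentBundle 𝓘(ℝ, E) M}
    (hp : p.proj ∈ frameDomain E x₀) {V : (x : M) → TangentSpace 𝓘(ℝ, E) x}
    (hVp : V p.proj = p.snd)
    (hV : MDifferentiableAt 𝓘(ℝ, E) 𝓘(ℝ, E).tangent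
      (fun x ↦ (⟨x, V x⟩ : TangentBundle 𝓘(ℝ, E) M)) p.proj) (u : TangentSpace 𝓘(ℝ, E) p.proj)
    {z : TangentSpace 𝓘(ℝ, E).tangent p}
    (hz : z = (mfderiv 𝓘(ℝ, E) 𝓘(ℝ, E).tangent
      (fun x ↦ (⟨x, V x⟩ : TangentBundle 𝓘(ℝ, E) M)) p.proj u : E × E)) :
    mvfderiv 𝓘(ℝ, E).tangent (fibreCoord x₀) p z =
      mvfderiv 𝓘(ℝ, E) (fun y ↦ fibreCoord x₀ ⟨y, V y⟩) p.proj u := by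
  obtain ⟨x, w⟩ := p
  obtain rfl : V x = w := hVp
  rw [hz]
  exact (congr($(mfderiv_comp x (mdifferentiableAt_fibreCoord hp) hV) u)).symm

/-- The definition of the horizontal lift with the image of `u` under the derivative of the extended
field as a vector tangent at `p`, in the form that `mfderiv_section_proj` and
`mfderiv_section_fibreCoord` accept. -/
lemma exists_hlft_eq (p : TangentBundle 𝓘(ℝ, E) M) (u : TangentSpace 𝓘(ℝ, E) p.proj) :
    ∃ z : TangentSpace 𝓘(ℝ, E).tangent p,
      z = (mfderiv 𝓘(ℝ, E) 𝓘(ℝ, E).tangent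
        (fun x ↦ (⟨x, FiberBundle.extend E p.snd x⟩ : TangentBundle 𝓘(ℝ, E) M)) p.proj u : E × E) ∧
      hlft cov p u = z - vlft p (cov (FiberBundle.extend E p.snd) p.proj u) :=
  ⟨_, rfl, rfl⟩

lemma hlft_proj (p : TangentBundle 𝓘(ℝ, E) M) (u : TangentSpace 𝓘(ℝ, E) p.proj) :
    mfderiv 𝓘(ℝ, E).tangent 𝓘(ℝ, E) (TotalSpace.proj : TangentBundle 𝓘(ℝ, E) M → M) p
      (hlft cov p u) = u := by
  obtain ⟨z, hz, hzu⟩ := exists_hlft_eq cov p u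
  rw [hzu, map_sub, vlft_proj, sub_zero]
  exact mfderiv_section_proj (FiberBundle.extend_apply_self _ _)
    (FiberBundle.mdifferentiableAt_extend 𝓘(ℝ, E) E p.snd) u hz

/-- The horizontal lift in fibre coordinates: minus the Christoffel term of the connection. -/
lemma hlft_fibreCoord [FiniteDimensional ℝ E] {x₀ : M} {p : TangentBundle 𝓘(ℝ, E) M}
    (hp : p.proj ∈ frameDomain E x₀) (u : TangentSpace 𝓘(ℝ, E) p.proj) :
    mvfderiv 𝓘(ℝ, E).tangent (fibreCoord x₀) p (hlft cov p u) =
      - fibreCoord x₀ ⟨p.proj, cov (constField x₀ (fibreCoord x₀ p)) p.proj u⟩ := by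
  have hV := FiberBundle.mdifferentiableAt_extend 𝓘(ℝ, E) E p.snd
  obtain ⟨z, hz, hzu⟩ := exists_hlft_eq cov p u
  rw [hzu, map_sub, vlft_fibreCoord hp, fibreCoord_cov cov hp hV, FiberBundle.extend_apply_self,
    mfderiv_section_fibreCoord hp (FiberBundle.extend_apply_self _ _) hV u hz]
  abel

/-- A curve `Y` in `TM` is parallel along its projection exactly if its velocity is the horizontal
lift of the velocity of its projection. -/
lemma covDerivAlong_eq_zero_iff [FiniteDimensional ℝ E] {Y : ℝ → TangentBundle 𝓘(ℝ, E) M} {s : ℝ}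
    (hY : MDifferentiableAt 𝓘(ℝ, ℝ) 𝓘(ℝ, E).tangent Y s) {u : TangentSpace 𝓘(ℝ, E) (Y s).proj}
    (hu : HasVelocityAt 𝓘(ℝ, E) (fun t ↦ (Y t).proj) s u) :
    covDerivAlong cov Y s = 0 ↔ HasVelocityAt 𝓘(ℝ, E).tangent Y s (hlft cov (Y s) u) := by
  have hp := mem_frameDomain (E := E) (Y s).proj
  obtain ⟨z, hz⟩ : ∃ z, HasVelocityAt 𝓘(ℝ, E).tangent Y s z :=
    ⟨_, hasVelocityAt_of_mfderiv_one hY rfl⟩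
  have hz1 : mfderiv 𝓘(ℝ, E).tangent 𝓘(ℝ, E) (TotalSpace.proj : TangentBundle 𝓘(ℝ, E) M → M) (Y s) z
      = u := by
    rw [← (hz.comp (mdifferentiableAt_tangentBundle_proj (Y s))).mfderiv_one, hu.mfderiv_one]
  have hz2 := hz.fibreCoord hp
  -- Near `(Y s).proj`, `FiberBundle.extend` is the field with constant coordinate in the
  -- trivialization there.
  have hcov : cov (FiberBundle.extend E (Y s).snd) (Y s).proj =
      cov (constField (Y s).proj (fibreCoord (Y s).proj (Y s))) (Y s).proj := by
    refine cov.isCovariantDerivativeOnUniv.congr_of_eventuallyEq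
      (FiberBundle.mdifferentiableAt_extend 𝓘(ℝ, E) E (Y s).snd)
      (mdifferentiableAt_constField hp _) univ_mem ?_
    filter_upwards [(isOpen_frameDomain (Y s).proj).mem_nhds hp] with y hy
    rw [extend_eq_constField hy]
    congr 1
    exact (fibreCoord_self _).symm
  have hlhs : covDerivAlong cov Y s =
      constField (Y s).proj (mvfderiv 𝓘(ℝ, E).tangent (fibreCoord (Y s).proj) (Y s) z) (Y s).proj +
        cov (constField (Y s).proj (fibreCoord (Y s).proj (Y s))) (Y s).proj u := by
    unfold covDerivAlong
    rw [hcov, hu.mfderiv_one, ← hz2.deriv]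
    exact congrArg (· + _) (Trivialization.symmL_apply (R := ℝ) _ hp _).symm
  have hkey : covDerivAlong cov Y s = 0 ↔ mvfderiv 𝓘(ℝ, E).tangent (fibreCoord (Y s).proj) (Y s) z =
      mvfderiv 𝓘(ℝ, E).tangent (fibreCoord (Y s).proj) (Y s) (hlft cov (Y s) u) := by
    rw [hlft_fibreCoord cov hp, hlhs, ← add_eq_zero_iff_eq_neg, constField_self,
      fibreCoord_self (cov (constField (Y s).proj (fibreCoord (Y s).proj (Y s))) (Y s).proj u)]
    rfl
  rw [hkey]
  constructor
  · intro h
    have : z = hlft cov (Y s) u :=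
      tangent_tangentBundle_ext hp (by rw [hz1, hlft_proj]) h
    exact this ▸ hz
  · intro h
    rw [← hz.mfderiv_one, h.mfderiv_one]

end Connection

end Coordinates

/-! ### Linear differential equations -/

section LinearODE

/-- Local existence for a linear differential equation with continuous coefficients. -/
lemma exists_hasDerivAt_linear {F : Type*} [NormedAddCommGroup F] [NormedSpace ℝ F]
    [CompleteSpace F] {B : ℝ → F →L[ℝ] F} (hB : ∀ᶠ s in 𝓝 (0 : ℝ), ContinuousAt B s) (x₀ : F) :
    ∃ ε > 0, ∃ α : ℝ → F, α 0 = x₀ ∧ ∀ s ∈ Ioo (-ε) ε, HasDerivAt α (B s (α s)) s := by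
  -- On `[-δ, δ]` the operators are bounded by `C`, hence the right-hand side by `L` on the unit
  -- ball around `x₀`, and a solution cannot leave that ball within time `δ ≤ 1 / L`.
  set C : ℝ := ‖B 0‖ + 1 with hC
  have hCpos : 0 < C := by positivity
  have hbd : ∀ᶠ s in 𝓝 (0 : ℝ), ‖B s‖ < C :=
    hB.self_of_nhds.norm.eventually_lt_const (by rw [hC]; linarith)
  obtain ⟨r, hr, hrB⟩ := Metric.eventually_nhds_iff.1 (hB.and hbd)
  set L : ℝ := C * (‖x₀‖ + 1) with hL
  have hLpos : 0 < L := by positivity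
  set δ : ℝ := min (r / 2) (1 / L) with hδ
  have hδpos : 0 < δ := by positivity
  have hmem : ∀ s ∈ Icc (-δ) δ, ContinuousAt B s ∧ ‖B s‖ < C := fun s hs ↦ by
    refine hrB ?_
    rw [Real.dist_eq, sub_zero]
    have h1 := abs_le.2 hs
    have h2 : δ ≤ r / 2 := min_le_left _ _
    linarith
  have h0 : (0 : ℝ) ∈ Icc (-δ) δ := ⟨by linarith, hδpos.le⟩
  have hPL : IsPicardLindelof (fun s x ↦ B s x) (⟨0, h0⟩ : Icc (-δ) δ) x₀ 1 0 ⟨L, hLpos.le⟩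
      ⟨C, hCpos.le⟩ := by
    refine ⟨fun t ht ↦ ?_, fun x _ t ht ↦ ?_, fun t ht x hx ↦ ?_, ?_⟩
    · have h : ‖B t‖₊ ≤ ⟨C, hCpos.le⟩ := (hmem t ht).2.le
      exact ((B t).lipschitz.weaken h).lipschitzOnWith
    · exact ((hmem t ht).1.clm_apply continuousAt_const).continuousWithinAt
    · have hx' : ‖x‖ ≤ ‖x₀‖ + 1 := by
        have h1 : ‖x - x₀‖ ≤ 1 := by simpa [dist_eq_norm] using hx
        have h2 := norm_add_le (x - x₀) x₀
        rw [sub_add_cancel] at h2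
        linarith
      calc ‖B t x‖ ≤ ‖B t‖ * ‖x‖ := (B t).le_opNorm x
        _ ≤ C * (‖x₀‖ + 1) := by
          gcongr
          exact (hmem t ht).2.le
    · have h1 : max (δ - 0) (0 - -δ) = δ := by simp
      change L * max (δ - 0) (0 - -δ) ≤ (1 : ℝ) - 0
      rw [h1, sub_zero]
      calc L * δ ≤ L * (1 / L) := by gcongr; exact min_le_right _ _
        _ = 1 := by field_simp
  obtain ⟨α, hα0, hα⟩ := hPL.exists_eq_forall_mem_Icc_hasDerivWithinAt
    (x := x₀) (by simp)
  exact ⟨δ, hδpos, α, hα0, fun s hs ↦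
    (hα s (Ioo_subset_Icc_self hs)).hasDerivAt (Icc_mem_nhds hs.1 hs.2)⟩

lemma eq_of_hasDerivAt_zero_Ioo {F : Type*} [NormedAddCommGroup F] [NormedSpace ℝ F]
    {α : ℝ → F} {a b s t : ℝ} (h : ∀ r ∈ Ioo a b, HasDerivAt α 0 r) (hs : s ∈ Ioo a b)
    (ht : t ∈ Ioo a b) : α s = α t :=
  isOpen_Ioo.is_const_of_deriv_eq_zero isPreconnected_Ioo
    (fun r hr ↦ (h r hr).differentiableAt.differentiableWithinAt)
    (fun r hr ↦ (h r hr).deriv) hs ht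

/-- The fundamental solution `P` of `w' = -A w`, together with its inverse `Q`. The product `Q P` is
constant by the equations; `Q` is a two-sided inverse since `P` is a unit for small times. -/
lemma exists_fundamental_solution {R : Type*} [NormedRing R] [NormedAlgebra ℝ R]
    [CompleteSpace R] {A : ℝ → R} (hA : ∀ᶠ s in 𝓝 (0 : ℝ), ContinuousAt A s) :
    ∃ ε > 0, ∃ P Q : ℝ → R, P 0 = 1 ∧ Q 0 = 1 ∧ ∀ s ∈ Ioo (-ε) ε,
      HasDerivAt P (-(A s * P s)) s ∧ HasDerivAt Q (Q s * A s) s ∧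
        P s * Q s = 1 ∧ Q s * P s = 1 := by
  obtain ⟨ε₁, hε₁, P, hP0, hP⟩ := exists_hasDerivAt_linear
    (B := fun s ↦ -ContinuousLinearMap.mul ℝ R (A s))
    (hA.mono fun s hs ↦ ((ContinuousLinearMap.mul ℝ R).continuous.continuousAt.comp hs).neg) 1
  obtain ⟨ε₂, hε₂, Q, hQ0, hQ⟩ := exists_hasDerivAt_linear
    (B := fun s ↦ (ContinuousLinearMap.mul ℝ R).flip (A s))
    (hA.mono fun s hs ↦ (ContinuousLinearMap.mul ℝ R).flip.continuous.continuousAt.comp hs) 1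
  simp only [neg_apply, ContinuousLinearMap.mul_apply',
    ContinuousLinearMap.flip_apply] at hP hQ
  have hPunit : ∀ᶠ s in 𝓝 (0 : ℝ), IsUnit (P s) := by
    have hc : ContinuousAt P 0 := (hP 0 ⟨by linarith, hε₁⟩).continuousAt
    exact hc.eventually (Units.isOpen.mem_nhds (by rw [hP0]; exact isUnit_one))
  obtain ⟨ε₃, hε₃, hU⟩ := Metric.eventually_nhds_iff.1 hPunit
  refine ⟨min (min ε₁ ε₂) ε₃, by positivity, P, Q, hP0, hQ0, fun s hs ↦ ?_⟩
  have hsub : ∀ r ∈ Ioo (-min (min ε₁ ε₂) ε₃) (min (min ε₁ ε₂) ε₃),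
      r ∈ Ioo (-ε₁) ε₁ ∧ r ∈ Ioo (-ε₂) ε₂ ∧ |r| < ε₃ := fun r hr ↦ by
    have h := abs_lt.2 hr
    rw [lt_min_iff, lt_min_iff] at h
    exact ⟨abs_lt.1 h.1.1, abs_lt.1 h.1.2, h.2⟩
  have hQP : Q s * P s = 1 := by
    have h : Q s * P s = Q 0 * P 0 := by
      refine eq_of_hasDerivAt_zero_Ioo (α := fun r ↦ Q r * P r) (fun r hr ↦ ?_) hs
        ⟨by rw [neg_lt_zero]; positivity, by positivity⟩
      have := (hQ r (hsub r hr).2.1).mul (hP r (hsub r hr).1)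
      rwa [mul_neg, mul_assoc, add_neg_cancel] at this
    rw [h, hP0, hQ0, one_mul]
  have hu : IsUnit (P s) := hU (by simpa using (hsub s hs).2.2)
  refine ⟨hP s (hsub s hs).1, hQ s (hsub s hs).2.1, ?_, hQP⟩
  obtain ⟨u, hu⟩ := hu
  rw [← hu] at hQP ⊢
  rw [left_inv_eq_right_inv hQP u.mul_inv, Units.mul_inv]

/-- Uniqueness of solutions of `w' = -A w`: the product `Q w` is constant. -/
lemma eq_of_hasDerivAt_of_fundamental_solution {E : Type*} [NormedAddCommGroup E]
    [NormedSpace ℝ E] {A P Q : ℝ → E →L[ℝ] E} {w : ℝ → E} {a b s t : ℝ}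
    (hQ : ∀ r ∈ Ioo a b, HasDerivAt Q (Q r * A r) r) (hPQ : ∀ r ∈ Ioo a b, P r * Q r = 1)
    (hw : ∀ r ∈ Ioo a b, HasDerivAt w (-A r (w r)) r) (hs : s ∈ Ioo a b) (ht : t ∈ Ioo a b) :
    w t = P t (Q s (w s)) := by
  have h : Q t (w t) = Q s (w s) := by
    refine eq_of_hasDerivAt_zero_Ioo (α := fun r ↦ Q r (w r)) (fun r hr ↦ ?_) ht hs
    have := (hQ r hr).clm_apply (hw r hr)
    convert this using 1
    simp
  rw [← h]
  exact (congr($(hPQ t ht) (w t))).symm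

end LinearODE

/-! ### Smoothness of the connection, Christoffel operators, and the torsion-free part -/

section Christoffel

variable {E : Type*} [NormedAddCommGroup E] [NormedSpace ℝ E]
  {M : Type*} [TopologicalSpace M] [ChartedSpace E M] [IsManifold 𝓘(ℝ, E) ∞ M]
  (cov : CovariantDerivative 𝓘(ℝ, E) E (TangentSpace 𝓘(ℝ, E) : M → Type _))

/-- `∇_X Y` is smooth whenever the vector fields `X` and `Y` are. -/
def PreservesSmooth : Prop :=
  ∀ {Y X : (x : M) → TangentSpace 𝓘(ℝ, E) x},
    ContMDiff 𝓘(ℝ, E) 𝓘(ℝ, E).tangent ∞ (fun x ↦ (⟨x, Y x⟩ : TangentBundle 𝓘(ℝ, E) M)) →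
    ContMDiff 𝓘(ℝ, E) 𝓘(ℝ, E).tangent ∞ (fun x ↦ (⟨x, X x⟩ : TangentBundle 𝓘(ℝ, E) M)) →
    ContMDiff 𝓘(ℝ, E) 𝓘(ℝ, E).tangent ∞
      (fun x ↦ (⟨x, cov Y x (X x)⟩ : TangentBundle 𝓘(ℝ, E) M))

lemma preservesSmooth_of_contMDiff (hcov : cov.ContMDiffCovariantDerivative ∞) :
    PreservesSmooth cov := by
  intro Y X hY hX x
  have h := hcov.contMDiff.contMDiff (σ := Y) (hY.contMDiffOn)
  exact ContMDiffAt.clm_bundle_apply (h.contMDiffAt univ_mem) (hX x)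

lemma preservesSmooth_torsionFreePart [FiniteDimensional ℝ E] (h : PreservesSmooth cov) :
    PreservesSmooth (torsionFreePart cov) := by
  intro Y X hY hX
  have hbr : ContMDiff 𝓘(ℝ, E) 𝓘(ℝ, E).tangent ∞
      (fun x ↦ (⟨x, VectorField.mlieBracket 𝓘(ℝ, E) Y X x⟩ : TangentBundle 𝓘(ℝ, E) M)) := by
    intro x
    have : IsManifold 𝓘(ℝ, E) (minSmoothness ℝ 2) M := by
      rw [minSmoothness_of_isRCLikeNormedField]
      infer_instance
    have : IsManifold 𝓘(ℝ, E) (((⊤ : ℕ∞) : WithTop ℕ∞) + 1) M := ‹IsManifold 𝓘(ℝ, E) ∞ M›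
    refine ContMDiffAt.mlieBracket_vectorField (m := ⊤) (n := ⊤) (hY x) (hX x) ?_
    rw [minSmoothness_of_isRCLikeNormedField]
    exact le_rfl
  -- `∇̄_X Y = ∇_X Y + ½ (∇_Y X - ∇_X Y - [Y, X])`
  have hsum := (h hY hX).add_section
    ((((h hX hY).sub_section (h hY hX)).sub_section hbr).const_smul_section (a := (1 / 2 : ℝ)))
  convert hsum using 3 with x
  change cov Y x (X x) + (1 / 2 : ℝ) • cov.torsion x (Y x) (X x) = _
  rw [cov.torsion_apply (hY.mdifferentiable (by simp) x) (hX.mdifferentiable (by simp) x)]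
  rfl

/-- The symmetric product is the same for `∇` and `∇̄`, since the torsion is antisymmetric. -/
lemma symmetricProduct_torsionFreePart [FiniteDimensional ℝ E]
    (X Y : (x : M) → TangentSpace 𝓘(ℝ, E) x) :
    symmetricProduct (torsionFreePart cov) X Y = symmetricProduct cov X Y := by
  funext x
  change (cov Y x (X x) + (1 / 2 : ℝ) • cov.torsion x (Y x) (X x)) +
    (cov X x (Y x) + (1 / 2 : ℝ) • cov.torsion x (X x) (Y x)) = cov Y x (X x) + cov X x (Y x)
  rw [cov.torsion_antisymm (X x) (Y x)]
  module

open Classical in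
/-- The endomorphism `w ↦ ∇_u w` of the model space, where `w` is regarded as the vector field that
is constant in the trivialization at `x₀`. Outside the base set of this trivialization it is set to
zero. -/
def christoffel [FiniteDimensional ℝ E] (x₀ x : M) (u : TangentSpace 𝓘(ℝ, E) x) : E →L[ℝ] E :=
  if hx : x ∈ frameDomain E x₀ then
    LinearMap.toContinuousLinearMap
      { toFun := fun w ↦ fibreCoord x₀ ⟨x, cov (constField x₀ w) x u⟩
        map_add' := fun w w' ↦ by
          rw [constField_add, cov.isCovariantDerivativeOnUniv.add
            (mdifferentiableAt_constField hx w) (mdifferentiableAt_constField hx w')]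
          exact fibreCoord_add hx _ _
        map_smul' := fun a w ↦ by
          rw [constField_smul, cov.isCovariantDerivativeOnUniv.smul_const a
            (mdifferentiableAt_constField hx w)]
          exact fibreCoord_smul hx _ _ }
  else 0

lemma christoffel_apply [FiniteDimensional ℝ E] {x₀ x : M} (hx : x ∈ frameDomain E x₀)
    (u : TangentSpace 𝓘(ℝ, E) x) (w : E) :
    christoffel cov x₀ x u w = fibreCoord x₀ ⟨x, cov (constField x₀ w) x u⟩ := by
  unfold christoffel
  rw [dif_pos hx]
  rfl

/-- Near `x₀`, the constant fields extend to globally smooth vector fields. -/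
lemma exists_smooth_eqOn_constField [FiniteDimensional ℝ E] [T2Space M] (x₀ : M) :
    ∃ U : Set M, IsOpen U ∧ x₀ ∈ U ∧ U ⊆ frameDomain E x₀ ∧
      ∀ w : E, ∃ σ : (x : M) → TangentSpace 𝓘(ℝ, E) x,
        ContMDiff 𝓘(ℝ, E) 𝓘(ℝ, E).tangent ∞ (fun x ↦ (⟨x, σ x⟩ : TangentBundle 𝓘(ℝ, E) M)) ∧
        ∀ x ∈ U, σ x = constField x₀ w x := by
  obtain ⟨ψ, -, hψ⟩ := (SmoothBumpFunction.nhds_basis_tsupport (I := 𝓘(ℝ, E)) x₀).mem_iff.1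
    ((isOpen_frameDomain x₀).mem_nhds (mem_frameDomain (E := E) x₀))
  obtain ⟨U, hU, hUo, hxU⟩ := mem_nhds_iff.1 ψ.eventuallyEq_one
  refine ⟨U ∩ frameDomain E x₀, hUo.inter (isOpen_frameDomain x₀), ⟨hxU, mem_frameDomain x₀⟩,
    inter_subset_right, fun w ↦ ⟨fun x ↦ ψ x • constField x₀ w x, ?_, fun x hx ↦ ?_⟩⟩
  · exact ContMDiffOn.smul_section_of_tsupport ψ.contMDiff.contMDiffOn (isOpen_frameDomain x₀) hψ
      (contMDiffOn_constField x₀ w)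
  · have h1 : ψ x = 1 := hU hx.1
    simp only [h1, one_smul]

/-- The Christoffel operators depend continuously on the point near `x₀`: there the constant fields
can be replaced by globally smooth ones, whose covariant derivatives are smooth. -/
lemma exists_continuousOn_christoffel [FiniteDimensional ℝ E] [T2Space M]
    (hcov : PreservesSmooth cov) (x₀ : M) :
    ∃ U : Set M, IsOpen U ∧ x₀ ∈ U ∧ U ⊆ frameDomain E x₀ ∧
      ∀ X : (x : M) → TangentSpace 𝓘(ℝ, E) x,
        ContMDiff 𝓘(ℝ, E) 𝓘(ℝ, E).tangent ∞ (fun x ↦ (⟨x, X x⟩ : TangentBundle 𝓘(ℝ, E) M)) →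
        ContinuousOn (fun x ↦ christoffel cov x₀ x (X x)) U := by
  obtain ⟨U, hUo, hxU, hU, hσ⟩ := exists_smooth_eqOn_constField (E := E) x₀
  refine ⟨U, hUo, hxU, hU, fun X hX ↦ continuousOn_clm_apply.2 fun w ↦ ?_⟩
  obtain ⟨σ, hσ, hσU⟩ := hσ w
  have h1 : ContinuousOn (fun x ↦ fibreCoord x₀ ⟨x, cov σ x (X x)⟩) U := fun x hx ↦
    ((contMDiffAt_fibreCoord (p := ⟨x, cov σ x (X x)⟩) (hU hx)).continuousAt.comp
      (f := fun x ↦ (⟨x, cov σ x (X x)⟩ : TangentBundle 𝓘(ℝ, E) M))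
      (hcov hσ hX).continuous.continuousAt).continuousWithinAt
  refine h1.congr fun x hx ↦ ?_
  rw [christoffel_apply cov (hU hx)]
  congr 3
  refine cov.isCovariantDerivativeOnUniv.congr_of_eventuallyEq
    (mdifferentiableAt_constField (hU hx) w) (hσ.mdifferentiable (by simp) x) univ_mem ?_
  filter_upwards [hUo.mem_nhds hx] with y hy
  exact (hσU y hy).symm

end Christoffel

/-! ### Flows of vertical lifts -/

section IntegralCurves

variable {E : Type*} [NormedAddCommGroup E] [NormedSpace ℝ E]
  {H : Type*} [TopologicalSpace H] {I : ModelWithCorners ℝ E H}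
  {N : Type*} [TopologicalSpace N] [ChartedSpace H N]

lemma isMIntegralCurveOn_Ioo_iff {γ : ℝ → N} {Z : (x : N) → TangentSpace I x} {a b : ℝ} :
    IsMIntegralCurveOn γ Z (Ioo a b) ↔ ∀ s ∈ Ioo a b, HasVelocityAt I γ s (Z (γ s)) :=
  ⟨fun h s hs ↦ (h s hs).hasMFDerivAt (Ioo_mem_nhds hs.1 hs.2),
    fun h s hs ↦ HasMFDerivAt.hasMFDerivWithinAt (h s hs)⟩

/-- For a velocity given by a vector field `Z`, changing the curve away from the time `s` changes
neither the value of `Z` nor the velocity. -/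
lemma HasVelocityAt.congr_of_eventuallyEq {c c' : ℝ → N} {s : ℝ} {Z : (x : N) → TangentSpace I x}
    (h : HasVelocityAt I c s (Z (c s))) (hc : c' =ᶠ[𝓝 s] c) : HasVelocityAt I c' s (Z (c' s)) := by
  have h0 : HasMFDerivAt 𝓘(ℝ, ℝ) I c s _ := h
  have h1 := h0.congr_of_eventuallyEq hc
  have h2 : (Z (c s) : E) = Z (c' s) := congrArg (fun x ↦ (Z x : E)) hc.self_of_nhds.symm
  refine hasVelocityAt_of_mfderiv_one h1.mdifferentiableAt ?_
  have h3 := congr($(h1.mfderiv) (1 : ℝ))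
  exact (h3.trans (one_smul ℝ (Z (c s) : E))).trans h2

lemma flow_eq_some {Z : (x : N) → TangentSpace I x} {t : ℝ} {p q : N} (h : FlowsTo Z t p q)
    (huniq : ∀ q', FlowsTo Z t p q' → q' = q) : flow Z t p = Part.some q :=
  Part.eq_some_iff.2 ⟨⟨q, h⟩, huniq _ (Exists.choose_spec (⟨q, h⟩ : ∃ q, FlowsTo Z t p q))⟩

end IntegralCurves

section VerticalFlow

variable {E : Type*} [NormedAddCommGroup E] [NormedSpace ℝ E]
  {M : Type*} [TopologicalSpace M] [ChartedSpace E M] [IsManifold 𝓘(ℝ, E) ∞ M]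

/-- The flow of a vertical lift translates the tangent spaces. -/
lemma flow_verticalLift [T2Space M] (X : (x : M) → TangentSpace 𝓘(ℝ, E) x) (t : ℝ)
    (p : TangentBundle 𝓘(ℝ, E) M) :
    flow (verticalLift X) t p = Part.some ⟨p.proj, p.snd + t • X p.proj⟩ := by
  have hp := mem_frameDomain (E := E) p.proj
  refine flow_eq_some ?_ ?_
  · refine ⟨fun s ↦ ⟨p.proj, p.snd + s • X p.proj⟩, -(|t| + 1), |t| + 1,
      ⟨by linarith [abs_nonneg t], by linarith [abs_nonneg t]⟩,
      ⟨by linarith [neg_abs_le t], by linarith [le_abs_self t]⟩,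
      isMIntegralCurveOn_Ioo_iff.2 fun s _ ↦ ?_, by simp, rfl⟩
    refine hasVelocityAt_tangentBundle (x₀ := p.proj) hp ?_ ?_
    · refine hasVelocityAt_of_mfderiv_one mdifferentiableAt_const ?_
      unfold verticalLift
      rw [vlft_proj, mfderiv_const]
      rfl
    · have h1 : (fun r : ℝ ↦ fibreCoord p.proj
          (⟨p.proj, p.snd + r • X p.proj⟩ : TangentBundle 𝓘(ℝ, E) M)) =
          fun r : ℝ ↦ fibreCoord p.proj p + r • fibreCoord p.proj ⟨p.proj, X p.proj⟩ := by
        funext r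
        rw [fibreCoord_add hp, fibreCoord_smul hp]
      unfold verticalLift
      rw [vlft_fibreCoord (p := ⟨p.proj, p.snd + s • X p.proj⟩) hp, h1]
      simpa using ((hasDerivAt_id s).smul_const (fibreCoord p.proj ⟨p.proj, X p.proj⟩)).const_add
        (fibreCoord p.proj p)
  · rintro q ⟨γ, a, b, h0, ht, hγ, hγ0, rfl⟩
    -- An integral curve stays in its fibre, where its fibre coordinate has constant derivative.
    rw [isMIntegralCurveOn_Ioo_iff] at hγ
    have hbase : ∀ s ∈ Ioo a b, (γ s).proj = p.proj := by
      have h1 : IsMIntegralCurveOn (fun s ↦ (γ s).proj)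
          (fun x : M ↦ (0 : TangentSpace 𝓘(ℝ, E) x)) (Ioo a b) := by
        refine isMIntegralCurveOn_Ioo_iff.2 fun s hs ↦ ?_
        have h2 := (hγ s hs).comp (mdifferentiableAt_tangentBundle_proj (γ s))
        unfold verticalLift at h2
        rwa [vlft_proj] at h2
      have h2 : IsMIntegralCurveOn (fun _ : ℝ ↦ p.proj)
          (fun x : M ↦ (0 : TangentSpace 𝓘(ℝ, E) x)) (Ioo a b) :=
        (isMIntegralCurve_const (v := fun x : M ↦ (0 : TangentSpace 𝓘(ℝ, E) x))
          rfl).isMIntegralCurveOn _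
      exact isMIntegralCurveOn_Ioo_eqOn_of_contMDiff_boundaryless h0
        (contMDiff_zeroSection ℝ (TangentSpace 𝓘(ℝ, E) : M → Type _)) h1 h2 (by simp [hγ0])
    have hfib : ∀ s ∈ Ioo a b, HasDerivAt (fun r ↦ fibreCoord p.proj (γ r) -
        r • fibreCoord p.proj ⟨p.proj, X p.proj⟩) 0 s := by
      intro s hs
      have hps : (γ s).proj ∈ frameDomain E p.proj := by rw [hbase s hs]; exact hp
      have h1 := (hγ s hs).fibreCoord hps
      have h2 : fibreCoord p.proj ⟨(γ s).proj, X (γ s).proj⟩ =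
          fibreCoord p.proj ⟨p.proj, X p.proj⟩ := by rw [hbase s hs]
      unfold verticalLift at h1
      rw [vlft_fibreCoord hps, h2] at h1
      simpa using h1.fun_sub ((hasDerivAt_id s).smul_const (fibreCoord p.proj ⟨p.proj, X p.proj⟩))
    have hend := eq_of_hasDerivAt_zero_Ioo hfib ht h0
    refine tangentBundle_ext (x₀ := p.proj) (by rw [hbase t ht]; exact hp) (hbase t ht) ?_
    rw [fibreCoord_add hp, fibreCoord_smul hp]
    rw [hγ0, zero_smul, sub_zero, sub_eq_iff_eq_add] at hend
    exact hend

end VerticalFlow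

/-! ### Parallel transport and flows of horizontal lifts -/

section Horizontal

lemma Ioo_max_neg_min_subset_and_mem {a b ε s t : ℝ} (hs : s ∈ Ioo (-ε) ε)
    (ht : t ∈ Ioo (-ε) ε) (hs' : s ∈ Ioo a b) (ht' : t ∈ Ioo a b) :
    Ioo (max a (-ε)) (min b ε) ⊆ Ioo (-ε) ε ∧ Ioo (max a (-ε)) (min b ε) ⊆ Ioo a b ∧
      s ∈ Ioo (max a (-ε)) (min b ε) ∧ t ∈ Ioo (max a (-ε)) (min b ε) := by
  rw [← Ioo_inter_Ioo]
  exact ⟨inter_subset_right, inter_subset_left, ⟨hs', hs⟩, ⟨ht', ht⟩⟩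

variable {E : Type*} [NormedAddCommGroup E] [NormedSpace ℝ E]
  {M : Type*} [TopologicalSpace M] [ChartedSpace E M] [IsManifold 𝓘(ℝ, E) ∞ M]
  [FiniteDimensional ℝ E]
  (cov : CovariantDerivative 𝓘(ℝ, E) E (TangentSpace 𝓘(ℝ, E) : M → Type _))

/-- Near time `0`, `η` is an integral curve of `X` in the domain of the trivialization at `x₀`, and
in that trivialization parallel transport along `η` from time `0` to time `s` is the operator
`P s`, with inverse `Q s`. -/
structure IsParallelFrame (X : (x : M) → TangentSpace 𝓘(ℝ, E) x) (x₀ : M) (η : ℝ → M) (ε : ℝ)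
    (P Q : ℝ → E →L[ℝ] E) : Prop where
  pos : 0 < ε
  mem_frameDomain : ∀ s ∈ Ioo (-ε) ε, η s ∈ frameDomain E x₀
  velocity : ∀ s ∈ Ioo (-ε) ε, HasVelocityAt 𝓘(ℝ, E) η s (X (η s))
  hasDerivAt : ∀ s ∈ Ioo (-ε) ε, HasDerivAt P (-(christoffel cov x₀ (η s) (X (η s)) * P s)) s
  hasDerivAt_inv : ∀ s ∈ Ioo (-ε) ε, HasDerivAt Q (Q s * christoffel cov x₀ (η s) (X (η s))) s
  mul_inv : ∀ s ∈ Ioo (-ε) ε, P s * Q s = 1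
  inv_mul : ∀ s ∈ Ioo (-ε) ε, Q s * P s = 1
  zero : P 0 = 1
  inv_zero : Q 0 = 1

/-- Along an integral curve `η` of `X`, parallel transport in the trivialization at `η 0` is the
fundamental solution of `w' = -Γ(X, w)`. -/
lemma exists_isParallelFrame [T2Space M] (hcov : PreservesSmooth cov)
    {X : (x : M) → TangentSpace 𝓘(ℝ, E) x}
    (hX : ContMDiff 𝓘(ℝ, E) 𝓘(ℝ, E).tangent ∞ (fun x ↦ (⟨x, X x⟩ : TangentBundle 𝓘(ℝ, E) M)))
    {η : ℝ → M} (hη : IsMIntegralCurveAt η X 0) :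
    ∃ ε P Q, IsParallelFrame cov X (η 0) η ε P Q := by
  obtain ⟨U, hUo, hxU, hU, hcont⟩ := exists_continuousOn_christoffel cov hcov (η 0)
  have hvel : ∀ᶠ s in 𝓝 (0 : ℝ), HasVelocityAt 𝓘(ℝ, E) η s (X (η s)) := hη
  have hcU : ∀ᶠ s in 𝓝 (0 : ℝ), η s ∈ U :=
    hvel.self_of_nhds.mdifferentiableAt.continuousAt.eventually (hUo.mem_nhds hxU)
  have hA : ∀ᶠ s in 𝓝 (0 : ℝ), ContinuousAt (fun s ↦ christoffel cov (η 0) (η s) (X (η s))) s := by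
    filter_upwards [hvel, hcU] with s hs hsU
    exact ContinuousAt.comp (f := η) ((hcont X hX).continuousAt (hUo.mem_nhds hsU))
      hs.mdifferentiableAt.continuousAt
  obtain ⟨ε₁, hε₁, P, Q, hP0, hQ0, hPQ⟩ := exists_fundamental_solution hA
  obtain ⟨ε₂, hε₂, h2⟩ := Metric.eventually_nhds_iff.1 (hvel.and hcU)
  have hsub : ∀ s ∈ Ioo (-min ε₁ ε₂) (min ε₁ ε₂), s ∈ Ioo (-ε₁) ε₁ ∧ dist s 0 < ε₂ := fun s hs ↦ by
    have h := abs_lt.2 hs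
    rw [lt_min_iff] at h
    exact ⟨abs_lt.1 h.1, by simpa using h.2⟩
  exact ⟨min ε₁ ε₂, P, Q, by positivity, fun s hs ↦ hU (h2 (hsub s hs).2).2,
    fun s hs ↦ (h2 (hsub s hs).2).1, fun s hs ↦ (hPQ s (hsub s hs).1).1,
    fun s hs ↦ (hPQ s (hsub s hs).1).2.1, fun s hs ↦ (hPQ s (hsub s hs).1).2.2.1,
    fun s hs ↦ (hPQ s (hsub s hs).1).2.2.2, hP0, hQ0⟩

variable {cov} {X : (x : M) → TangentSpace 𝓘(ℝ, E) x} {x₀ : M} {η : ℝ → M} {ε : ℝ}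
  {P Q : ℝ → E →L[ℝ] E}

namespace IsParallelFrame

/-- The vectors with fibre coordinate `P t c` form an integral curve of the horizontal lift. -/
lemma hasVelocityAt_constField (h : IsParallelFrame cov X x₀ η ε P Q) (c : E) {s : ℝ}
    (hs : s ∈ Ioo (-ε) ε) :
    HasVelocityAt 𝓘(ℝ, E).tangent
      (fun t ↦ (⟨η t, constField x₀ (P t c) (η t)⟩ : TangentBundle 𝓘(ℝ, E) M)) s
      (horizontalLift cov X ⟨η s, constField x₀ (P s c) (η s)⟩) := by
  have hp := h.mem_frameDomain s hs
  refine hasVelocityAt_tangentBundle (x₀ := x₀) hp ?_ ?_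
  · unfold horizontalLift
    rw [hlft_proj]
    exact h.velocity s hs
  · unfold horizontalLift
    rw [hlft_fibreCoord cov (p := ⟨η s, constField x₀ (P s c) (η s)⟩) hp,
      fibreCoord_constField hp]
    have h1 : HasDerivAt (fun t ↦ P t c) (-(christoffel cov x₀ (η s) (X (η s)) (P s c))) s := by
      simpa using (h.hasDerivAt s hs).clm_apply (hasDerivAt_const s c)
    rw [christoffel_apply cov hp] at h1
    refine h1.congr_of_eventuallyEq ?_
    filter_upwards [Ioo_mem_nhds hs.1 hs.2] with t ht
    exact fibreCoord_constField (h.mem_frameDomain t ht) _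

/-- A curve over `η` that follows the horizontal lift is given by the parallel frame. -/
lemma eq_of_hasVelocityAt (h : IsParallelFrame cov X x₀ η ε P Q) {Y : ℝ → TangentBundle 𝓘(ℝ, E) M}
    {a b s t : ℝ} (hab : Ioo a b ⊆ Ioo (-ε) ε) (hproj : ∀ r ∈ Ioo a b, (Y r).proj = η r)
    (hY : ∀ r ∈ Ioo a b, HasVelocityAt 𝓘(ℝ, E).tangent Y r (horizontalLift cov X (Y r)))
    (hs : s ∈ Ioo a b) (ht : t ∈ Ioo a b) :
    Y t = ⟨η t, constField x₀ (P t (Q s (fibreCoord x₀ (Y s)))) (η t)⟩ := by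
  have hmem : ∀ r ∈ Ioo a b, (Y r).proj ∈ frameDomain E x₀ := fun r hr ↦ by
    rw [hproj r hr]
    exact h.mem_frameDomain r (hab hr)
  refine tangentBundle_ext (hmem t ht) (hproj t ht) ?_
  rw [fibreCoord_constField (h.mem_frameDomain t (hab ht))]
  refine eq_of_hasDerivAt_of_fundamental_solution (w := fun r ↦ fibreCoord x₀ (Y r))
    (fun r hr ↦ h.hasDerivAt_inv r (hab hr)) (fun r hr ↦ h.mul_inv r (hab hr)) (fun r hr ↦ ?_) hs ht
  have h1 := (hY r hr).fibreCoord (hmem r hr)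
  unfold horizontalLift at h1
  rw [hlft_fibreCoord cov (hmem r hr), ← christoffel_apply cov (hmem r hr)] at h1
  have h2 : christoffel cov x₀ (Y r).proj (X (Y r).proj) = christoffel cov x₀ (η r) (X (η r)) := by
    rw [hproj r hr]
  rwa [h2] at h1

lemma parallelTransport_eq (h : IsParallelFrame cov X x₀ η ε P Q) {s t : ℝ} (hs : s ∈ Ioo (-ε) ε)
    (ht : t ∈ Ioo (-ε) ε) (w : E) :
    parallelTransport cov η t s ⟨η s, constField x₀ w (η s)⟩ =
      Part.some ⟨η t, constField x₀ (P t (Q s w)) (η t)⟩ := by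
  have hex : TransportsTo cov η s t ⟨η s, constField x₀ w (η s)⟩
      ⟨η t, constField x₀ (P t (Q s w)) (η t)⟩ := by
    refine ⟨fun r ↦ ⟨η r, constField x₀ (P r (Q s w)) (η r)⟩, -ε, ε, hs, ht, fun r hr ↦ ?_, ?_, rfl⟩
    · have hv := h.hasVelocityAt_constField (Q s w) hr
      exact ⟨rfl, hv.mdifferentiableAt,
        (covDerivAlong_eq_zero_iff cov hv.mdifferentiableAt (h.velocity r hr)).2 hv⟩
    · have : P s (Q s w) = w := congr($(h.mul_inv s hs) w)
      simp only [this]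
  have huniq : ∀ q, TransportsTo cov η s t ⟨η s, constField x₀ w (η s)⟩ q →
      q = ⟨η t, constField x₀ (P t (Q s w)) (η t)⟩ := by
    rintro q ⟨Y, a, b, hsab, htab, hY, hYs, rfl⟩
    obtain ⟨h1, h2, h3, h4⟩ := Ioo_max_neg_min_subset_and_mem hs ht hsab htab
    have h5 := h.eq_of_hasVelocityAt h1 (fun r hr ↦ (hY r (h2 hr)).1) (fun r hr ↦ ?_) h3 h4
    · rwa [hYs, fibreCoord_constField (h.mem_frameDomain s hs)] at h5
    · obtain ⟨-, hYd, hY0⟩ := hY r (h2 hr)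
      refine (covDerivAlong_eq_zero_iff cov hYd ?_).1 hY0
      refine (h.velocity r (h1 hr)).congr_of_eventuallyEq (c' := fun t ↦ (Y t).proj) ?_
      filter_upwards [Ioo_mem_nhds (h2 hr).1 (h2 hr).2] with t ht
      exact (hY t ht).1
  exact Part.eq_some_iff.2 ⟨⟨_, hex⟩, huniq _ (Exists.choose_spec (⟨_, hex⟩ : ∃ q, _))⟩

/-- The flow of the horizontal lift of `X` over an integral curve of `X` is parallel transport. The
times `s` and `t` are arbitrary, so that `s = 0` gives the flow along `η` and `t = 0`
the flow back. -/
lemma flow_horizontalLift_eq [T2Space M] (h : IsParallelFrame cov X x₀ η ε P Q)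
    (hX : ContMDiff 𝓘(ℝ, E) 𝓘(ℝ, E).tangent ∞ (fun x ↦ (⟨x, X x⟩ : TangentBundle 𝓘(ℝ, E) M)))
    {s t : ℝ} (hs : s ∈ Ioo (-ε) ε) (ht : t ∈ Ioo (-ε) ε) (w : E) :
    flow (horizontalLift cov X) (t - s) ⟨η s, constField x₀ w (η s)⟩ =
      Part.some ⟨η t, constField x₀ (P t (Q s w)) (η t)⟩ := by
  refine flow_eq_some ?_ ?_
  · set Y : ℝ → TangentBundle 𝓘(ℝ, E) M := fun r ↦ ⟨η r, constField x₀ (P r (Q s w)) (η r)⟩ with hY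
    have hYs : Y s = ⟨η s, constField x₀ w (η s)⟩ := by
      have : P s (Q s w) = w := congr($(h.mul_inv s hs) w)
      simp only [hY, this]
    refine ⟨fun r ↦ Y (r + s), -ε - s, ε - s, ⟨by linarith [hs.1], by linarith [hs.2]⟩,
      ⟨by linarith [ht.1], by linarith [ht.2]⟩, ?_,
      (congrArg Y (zero_add s)).trans hYs, congrArg Y (sub_add_cancel t s)⟩
    have h1 : IsMIntegralCurveOn Y (horizontalLift cov X) (Ioo (-ε) ε) :=
      isMIntegralCurveOn_Ioo_iff.2 fun r hr ↦ h.hasVelocityAt_constField (Q s w) hr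
    have h2 := h1.comp_add s
    refine h2.mono fun r hr ↦ ?_
    exact ⟨by linarith [hr.1], by linarith [hr.2]⟩
  · rintro q ⟨γ, a, b, h0, hts, hγ, hγ0, rfl⟩
    set Y : ℝ → TangentBundle 𝓘(ℝ, E) M := fun r ↦ γ (r - s) with hYdef
    have hY : IsMIntegralCurveOn Y (horizontalLift cov X) (Ioo (a + s) (b + s)) := by
      have h2 := hγ.comp_add (-s)
      refine h2.mono fun r hr ↦ ?_
      exact ⟨by linarith [hr.1], by linarith [hr.2]⟩
    rw [isMIntegralCurveOn_Ioo_iff] at hY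
    obtain ⟨h1, h2, h3, h4⟩ := Ioo_max_neg_min_subset_and_mem (a := a + s) (b := b + s) hs ht
      ⟨by linarith [h0.1], by linarith [h0.2]⟩ ⟨by linarith [hts.1], by linarith [hts.2]⟩
    have hYs : Y s = ⟨η s, constField x₀ w (η s)⟩ := by rw [hYdef, ← hγ0]; simp
    -- The projection is an integral curve of `X` through `η s`, hence agrees with `η`.
    have hproj : EqOn (fun r ↦ (Y r).proj) η (Ioo (max (a + s) (-ε)) (min (b + s) ε)) := by
      refine isMIntegralCurveOn_Ioo_eqOn_of_contMDiff_boundaryless h3 (hX.of_le (by simp))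
        (isMIntegralCurveOn_Ioo_iff.2 fun r hr ↦ ?_)
        (isMIntegralCurveOn_Ioo_iff.2 fun r hr ↦ h.velocity r (h1 hr)) (by simp only [hYs])
      have h5 := (hY r (h2 hr)).comp (mdifferentiableAt_tangentBundle_proj (Y r))
      unfold horizontalLift at h5
      rwa [hlft_proj] at h5
    have h5 := h.eq_of_hasVelocityAt h1 hproj (fun r hr ↦ hY r (h2 hr)) h3 h4
    rwa [hYs, fibreCoord_constField (h.mem_frameDomain s hs)] at h5

end IsParallelFrame

end Horizontal

/-! ### Second derivatives of curves in a tangent space -/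

/-- The product rule for `t • k t` at `0` needs only continuity of `k`. -/
lemma hasDerivAt_id_smul_of_continuousAt {E : Type*} [NormedAddCommGroup E] [NormedSpace ℝ E]
    {k : ℝ → E} (hk : ContinuousAt k 0) : HasDerivAt (fun t : ℝ ↦ t • k t) (k 0) 0 := by
  rw [hasDerivAt_iff_tendsto_slope_zero]
  refine (hk.tendsto.mono_left nhdsWithin_le_nhds).congr' ?_
  filter_upwards [self_mem_nhdsWithin] with t ht
  have ht' : t ≠ 0 := ht
  simp [smul_smul, ht']

section SecondDerivative

variable {E : Type*} [NormedAddCommGroup E] [NormedSpace ℝ E]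
  {M : Type*} [TopologicalSpace M] [ChartedSpace E M] [IsManifold 𝓘(ℝ, E) ∞ M]

lemma contMDiff_constField_fibre (x : M) :
    ContMDiff 𝓘(ℝ, E) 𝓘(ℝ, E).tangent ∞
      (fun w : E ↦ (⟨x, constField x w x⟩ : TangentBundle 𝓘(ℝ, E) M)) := by
  intro w
  rw [(trivializationAt E (TangentSpace 𝓘(ℝ, E) : M → Type _) x).contMDiffAt_iff
    (mem_trivializationAt_source (mem_frameDomain x))]
  refine ⟨contMDiffAt_const, contMDiffAt_id.congr_of_eventuallyEq (.of_forall fun w' ↦ ?_)⟩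
  exact fibreCoord_constField (mem_frameDomain x) w'

lemma constField_fibreCoord_total (p : TangentBundle 𝓘(ℝ, E) M) :
    (⟨p.proj, constField p.proj (fibreCoord p.proj p) p.proj⟩ : TangentBundle 𝓘(ℝ, E) M) = p := by
  obtain ⟨x, u⟩ := p
  rw [constField_fibreCoord (mem_frameDomain x)]

/-- A curve `t ↦ v + t (G(t) - G(0))` in a tangent space has second derivative `2 G'(0)`. The
function `G` need only be continuously differentiable: the derivative `G(t) - G(0) + t G'(t)` is
differentiable at `0` because `G'` is continuous there. -/
lemma hasSecondMDerivAt_of_eventuallyEq {G G' : ℝ → E}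
    (hG : ∀ᶠ t in 𝓝 (0 : ℝ), HasDerivAt G (G' t) t) (hG' : ContinuousAt G' 0)
    {c : ℝ → TangentBundle 𝓘(ℝ, E) M}
    (hc : c =ᶠ[𝓝 0] fun t ↦ ⟨(c 0).proj, constField (c 0).proj
      (fibreCoord (c 0).proj (c 0) + t • (G t - G 0)) (c 0).proj⟩) :
    HasSecondMDerivAt 𝓘(ℝ, E).tangent c 0
      (vlft (c 0) (show TangentSpace 𝓘(ℝ, E) (c 0).proj from (2 : ℝ) • G' 0)) := by
  set x := (c 0).proj with hx
  set w := fibreCoord x (c 0) with hw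
  set j : E → TangentBundle 𝓘(ℝ, E) M := fun w ↦ ⟨x, constField x w x⟩ with hj
  have hjw : j w = c 0 := constField_fibreCoord_total (c 0)
  set k : ℝ → E := fun t ↦ w + t • (G t - G 0) with hk
  set k' : ℝ → E := fun t ↦ (G t - G 0) + t • G' t with hk'
  have hk0 : k 0 = w := by simp [hk]
  have hk'0 : k' 0 = 0 := by simp [hk']
  have hkd : ∀ᶠ t in 𝓝 (0 : ℝ), HasDerivAt k (k' t) t := by
    filter_upwards [hG] with t ht
    have h := ((hasDerivAt_id t).fun_smul (ht.sub_const (G 0))).const_add w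
    exact h.congr_deriv (by simp only [hk', id, one_smul, add_comm])
  have hk'd : HasDerivAt k' ((2 : ℝ) • G' 0) 0 := by
    have h := (hG.self_of_nhds.sub_const (G 0)).fun_add (hasDerivAt_id_smul_of_continuousAt hG')
    rwa [← two_smul ℝ] at h
  have hkc : ContinuousAt k 0 := hkd.self_of_nhds.continuousAt
  constructor
  · have h1 : HasMFDerivAt 𝓘(ℝ, ℝ) 𝓘(ℝ, E) k 0 (0 : ℝ →L[ℝ] E) := by
      have h := hkd.self_of_nhds.hasFDerivAt
      rw [hk'0] at h
      rw [ContinuousLinearMap.toSpanSingleton_zero] at h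
      exact h.hasMFDerivAt
    have h2 := ((contMDiff_constField_fibre x).mdifferentiable
      (by simp) (k 0)).hasMFDerivAt.comp 0 h1
    have h3 : HasMFDerivAt 𝓘(ℝ, ℝ) 𝓘(ℝ, E).tangent c 0 _ := h2.congr_of_eventuallyEq hc
    exact h3.congr_mfderiv (ContinuousLinearMap.comp_zero _)
  · intro f hf
    set F : E → ℝ := fun w ↦ f (j w) with hF
    have hFs : ContDiffAt ℝ ∞ F w := by
      rw [← contMDiffAt_iff_contDiffAt]
      refine ContMDiffAt.comp (I' := 𝓘(ℝ, E).tangent) w ?_ (contMDiff_constField_fibre x w)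
      change ContMDiffAt _ _ _ f (j w)
      rwa [hjw]
    have hFd : ∀ᶠ w' in 𝓝 w, DifferentiableAt ℝ F w' := by
      have h := (hFs.of_le (m := 1) (by simp)).eventually (by decide)
      filter_upwards [h] with w' h'
      exact h'.differentiableAt (by simp)
    have hfc : f ∘ c =ᶠ[𝓝 0] F ∘ k := by
      filter_upwards [hc] with t ht
      simp only [Function.comp_apply, ht, hF, hj, hk]
    have hderiv : ∀ᶠ t in 𝓝 (0 : ℝ), HasDerivAt (f ∘ c) (fderiv ℝ F (k t) (k' t)) t := by
      have h1 : ∀ᶠ t in 𝓝 (0 : ℝ), DifferentiableAt ℝ F (k t) := by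
        have : Tendsto k (𝓝 0) (𝓝 w) := hk0 ▸ hkc.tendsto
        exact this.eventually hFd
      filter_upwards [h1, hkd, hfc.eventuallyEq_nhds] with t h1 h2 h3
      exact (h1.hasFDerivAt.comp_hasDerivAt t h2).congr_of_eventuallyEq h3
    refine ⟨hderiv.mono fun t ht ↦ ht.differentiableAt, ?_⟩
    have h2 : DifferentiableAt ℝ (fderiv ℝ F) (k 0) := by
      rw [hk0]
      have h : ContDiffAt ℝ 1 (fderiv ℝ F) w :=
        hFs.fderiv_right (by rw [one_add_one_eq_two]; exact ENat.LEInfty.out)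
      exact h.differentiableAt (by simp)
    have h3 := (h2.hasFDerivAt.comp_hasDerivAt (0 : ℝ) hkd.self_of_nhds).clm_apply hk'd
    have h4 : (mfderiv 𝓘(ℝ, E).tangent 𝓘(ℝ, ℝ) f (c 0)
        (vlft (c 0) (show TangentSpace 𝓘(ℝ, E) (c 0).proj from (2 : ℝ) • G' 0)) : ℝ) =
        fderiv ℝ F w ((2 : ℝ) • G' 0) := by
      refine mfderiv_vlft (hf.mdifferentiableAt (by simp)) _ (hasVelocityAt_iff_hasDerivAt.2 ?_)
      have h5 : (fun t : ℝ ↦ f ⟨(c 0).proj, (c 0).snd +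
          t • (show TangentSpace 𝓘(ℝ, E) (c 0).proj from (2 : ℝ) • G' 0)⟩) =
          fun t : ℝ ↦ F (w + t • ((2 : ℝ) • G' 0)) := by
        funext t
        simp only [hF, hj]
        rw [constField_self, hw]
        congr 2
        exact congrArg (· + _) (fibreCoord_self (c 0).snd).symm
      rw [h5]
      have h6 : HasDerivAt (fun t : ℝ ↦ w + t • ((2 : ℝ) • G' 0)) ((2 : ℝ) • G' 0) 0 := by
        simpa using ((hasDerivAt_id (0 : ℝ)).smul_const ((2 : ℝ) • G' 0)).const_add w
      refine HasFDerivAt.comp_hasDerivAt (0 : ℝ) (l := F) ?_ h6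
      rw [zero_smul, add_zero]
      exact hFd.self_of_nhds.hasFDerivAt
    rw [h4]
    have h7 : HasDerivAt (fun t ↦ fderiv ℝ F (k t) (k' t)) (fderiv ℝ F w ((2 : ℝ) • G' 0)) 0 := by
      exact h3.congr_deriv (by rw [hk'0, map_zero, zero_add, Function.comp_apply, hk0])
    exact h7.congr_of_eventuallyEq (hderiv.mono fun t ht ↦ ht.deriv)

end SecondDerivative

/-! ### Loops of flows and parallel transports -/

section Loops

variable {E : Type*} [NormedAddCommGroup E] [NormedSpace ℝ E]
  {M : Type*} [TopologicalSpace M] [ChartedSpace E M] [IsManifold 𝓘(ℝ, E) ∞ M]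

lemma flow_verticalLift_constField [T2Space M] (Y : (x : M) → TangentSpace 𝓘(ℝ, E) x) (t : ℝ)
    {x₀ x : M} (hx : x ∈ frameDomain E x₀) (w : E) :
    flow (verticalLift Y) t ⟨x, constField x₀ w x⟩ =
      Part.some ⟨x, constField x₀ (w + t • fibreCoord x₀ ⟨x, Y x⟩) x⟩ := by
  rw [flow_verticalLift, constField_add, constField_smul, Pi.add_apply, Pi.smul_apply,
    constField_fibreCoord hx]

/-- `Part.bind_some` for a partial function, which is not syntactically a function to `Part α`. -/
lemma some_bind_pfun {α : Type*} (a : α) (f : α →. α) : (Part.some a >>= f) = f a :=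
  Part.bind_some a f

/-- Transport by `P` along a curve from `x₀`, translation by `t Y`, transport back by `Q`, and
translation by `-t Y` amount to a translation of the tangent space at `x₀`. -/
lemma bind_loop_eq [T2Space M] {T₁ T₂ : TangentBundle 𝓘(ℝ, E) M →. TangentBundle 𝓘(ℝ, E) M}
    (Y : (x : M) → TangentSpace 𝓘(ℝ, E) x) {x₀ x : M} (hx : x ∈ frameDomain E x₀)
    {P Q : E →L[ℝ] E} (hQP : Q * P = 1)
    (h₁ : ∀ w, T₁ ⟨x₀, constField x₀ w x₀⟩ = Part.some ⟨x, constField x₀ (P w) x⟩)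
    (h₂ : ∀ w, T₂ ⟨x, constField x₀ w x⟩ = Part.some ⟨x₀, constField x₀ (Q w) x₀⟩)
    (t : ℝ) (w : E) :
    (T₁ ⟨x₀, constField x₀ w x₀⟩ >>= flow (verticalLift Y) t >>= T₂ >>=
      flow (verticalLift Y) (-t)) = Part.some ⟨x₀, constField x₀
        (w + t • (Q (fibreCoord x₀ ⟨x, Y x⟩) - fibreCoord x₀ ⟨x₀, Y x₀⟩)) x₀⟩ := by
  rw [h₁, some_bind_pfun, flow_verticalLift_constField Y _ hx, some_bind_pfun, h₂, some_bind_pfun,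
    flow_verticalLift_constField Y _ (mem_frameDomain x₀)]
  congr 3
  have h : Q (P w) = w := congr($hQP w)
  rw [map_add, map_smul, h]
  module

variable [FiniteDimensional ℝ E]
  {cov : CovariantDerivative 𝓘(ℝ, E) E (TangentSpace 𝓘(ℝ, E) : M → Type _)}
  {X Y : (x : M) → TangentSpace 𝓘(ℝ, E) x} {x₀ : M} {η : ℝ → M} {ε : ℝ} {P Q : ℝ → E →L[ℝ] E}

namespace IsParallelFrame

/-- The derivative of a vector field pulled back to `x₀` by parallel transport is the pull-back of
its covariant derivative. -/
lemma hasDerivAt_inv_fibreCoord (h : IsParallelFrame cov X x₀ η ε P Q)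
    (hY : ContMDiff 𝓘(ℝ, E) 𝓘(ℝ, E).tangent ∞ (fun x ↦ (⟨x, Y x⟩ : TangentBundle 𝓘(ℝ, E) M)))
    {s : ℝ} (hs : s ∈ Ioo (-ε) ε) :
    HasDerivAt (fun t ↦ Q t (fibreCoord x₀ ⟨η t, Y (η t)⟩))
      (Q s (fibreCoord x₀ ⟨η s, cov Y (η s) (X (η s))⟩)) s := by
  have hp := h.mem_frameDomain s hs
  have hYs := hY.mdifferentiable (by simp) (η s)
  have h1 : HasDerivAt (fun t ↦ fibreCoord x₀ ⟨η t, Y (η t)⟩)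
      (mvfderiv 𝓘(ℝ, E) (fun y ↦ fibreCoord x₀ ⟨y, Y y⟩) (η s) (X (η s))) s :=
    hasVelocityAt_iff_hasDerivAt.1
      ((h.velocity s hs).comp (mdifferentiableAt_fibreCoord_section hp hYs))
  refine ((h.hasDerivAt_inv s hs).clm_apply h1).congr_deriv ?_
  rw [fibreCoord_cov cov hp hYs, ← christoffel_apply cov hp, map_add, add_comm]
  rfl

lemma continuousAt_inv_fibreCoord (h : IsParallelFrame cov X x₀ η ε P Q)
    (hcov : PreservesSmooth cov)
    (hX : ContMDiff 𝓘(ℝ, E) 𝓘(ℝ, E).tangent ∞ (fun x ↦ (⟨x, X x⟩ : TangentBundle 𝓘(ℝ, E) M)))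
    (hY : ContMDiff 𝓘(ℝ, E) 𝓘(ℝ, E).tangent ∞ (fun x ↦ (⟨x, Y x⟩ : TangentBundle 𝓘(ℝ, E) M))) :
    ContinuousAt (fun s ↦ Q s (fibreCoord x₀ ⟨η s, cov Y (η s) (X (η s))⟩)) 0 := by
  have h0 : (0 : ℝ) ∈ Ioo (-ε) ε := ⟨neg_lt_zero.2 h.pos, h.pos⟩
  refine (h.hasDerivAt_inv 0 h0).continuousAt.clm_apply ?_
  have h1 : ContinuousAt (fun s ↦ (⟨η s, cov Y (η s) (X (η s))⟩ : TangentBundle 𝓘(ℝ, E) M)) 0 :=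
    ContinuousAt.comp (f := η) (g := fun x ↦ (⟨x, cov Y x (X x)⟩ : TangentBundle 𝓘(ℝ, E) M))
      (hcov hY hX).continuous.continuousAt (h.velocity 0 h0).mdifferentiableAt.continuousAt
  exact ContinuousAt.comp (f := fun s ↦ (⟨η s, cov Y (η s) (X (η s))⟩ : TangentBundle 𝓘(ℝ, E) M))
    (contMDiffAt_fibreCoord (h.mem_frameDomain 0 h0)).continuousAt h1

lemma flow_loop_eq [T2Space M] (h : IsParallelFrame cov X x₀ η ε P Q) (hη : η 0 = x₀)
    (hX : ContMDiff 𝓘(ℝ, E) 𝓘(ℝ, E).tangent ∞ (fun x ↦ (⟨x, X x⟩ : TangentBundle 𝓘(ℝ, E) M)))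
    (Y : (x : M) → TangentSpace 𝓘(ℝ, E) x) {t : ℝ} (ht : t ∈ Ioo (-ε) ε) (w : E) :
    (flow (horizontalLift cov X) t ⟨x₀, constField x₀ w x₀⟩ >>= flow (verticalLift Y) t >>=
      flow (horizontalLift cov X) (-t) >>= flow (verticalLift Y) (-t)) =
      Part.some ⟨x₀, constField x₀ (w + t • (Q t (fibreCoord x₀ ⟨η t, Y (η t)⟩) -
        Q 0 (fibreCoord x₀ ⟨η 0, Y (η 0)⟩))) x₀⟩ := by
  have h0 : (0 : ℝ) ∈ Ioo (-ε) ε := ⟨neg_lt_zero.2 h.pos, h.pos⟩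
  rw [h.inv_zero, hη]
  refine bind_loop_eq Y (h.mem_frameDomain t ht) (h.inv_mul t ht) (fun w ↦ ?_) (fun w ↦ ?_) t w
  · have h1 := h.flow_horizontalLift_eq hX h0 ht w
    rwa [h.inv_zero, sub_zero, hη] at h1
  · have h1 := h.flow_horizontalLift_eq hX ht h0 w
    rwa [h.zero, zero_sub, hη] at h1

lemma transport_loop_eq [T2Space M] (h : IsParallelFrame cov X x₀ η ε P Q) (hη : η 0 = x₀)
    (Y : (x : M) → TangentSpace 𝓘(ℝ, E) x) {t : ℝ} (ht : t ∈ Ioo (-ε) ε) (w : E) :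
    (parallelTransport cov η t 0 ⟨x₀, constField x₀ w x₀⟩ >>= flow (verticalLift Y) t >>=
      parallelTransport cov η 0 t >>= flow (verticalLift Y) (-t)) =
      Part.some ⟨x₀, constField x₀ (w + t • (Q t (fibreCoord x₀ ⟨η t, Y (η t)⟩) -
        Q 0 (fibreCoord x₀ ⟨η 0, Y (η 0)⟩))) x₀⟩ := by
  have h0 : (0 : ℝ) ∈ Ioo (-ε) ε := ⟨neg_lt_zero.2 h.pos, h.pos⟩
  rw [h.inv_zero, hη]
  refine bind_loop_eq Y (h.mem_frameDomain t ht) (h.inv_mul t ht) (fun w ↦ ?_) (fun w ↦ ?_) t w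
  · have h1 := h.parallelTransport_eq h0 ht w
    rwa [h.inv_zero, hη] at h1
  · have h1 := h.parallelTransport_eq ht h0 w
    rwa [h.zero, hη] at h1

end IsParallelFrame

/-- The common form of the four compositions near time `0`: a curve `v + t (G(t) - G(0))` in
`T_x M`, where `G'(0)` is the symmetric product. The value is called `q` so that the flows and the
parallel transports share it. -/
lemma exists_eventually_upsilon_eq [T2Space M] (hcov : PreservesSmooth cov)
    {X₁ X₂ : (x : M) → TangentSpace 𝓘(ℝ, E) x}
    (hX₁ : ContMDiff 𝓘(ℝ, E) 𝓘(ℝ, E).tangent ∞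
      (fun x ↦ (⟨x, X₁ x⟩ : TangentBundle 𝓘(ℝ, E) M)))
    (hX₂ : ContMDiff 𝓘(ℝ, E) 𝓘(ℝ, E).tangent ∞
      (fun x ↦ (⟨x, X₂ x⟩ : TangentBundle 𝓘(ℝ, E) M)))
    (v : TangentBundle 𝓘(ℝ, E) M) {η₁ η₂ : ℝ → M}
    (hη₁ : IsMIntegralCurveAt η₁ X₁ 0) (hη₁_zero : η₁ 0 = v.proj)
    (hη₂ : IsMIntegralCurveAt η₂ X₂ 0) (hη₂_zero : η₂ 0 = v.proj) :
    ∃ G G' : ℝ → E, (∀ᶠ t in 𝓝 (0 : ℝ), HasDerivAt G (G' t) t) ∧ ContinuousAt G' 0 ∧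
      G' 0 = symmetricProduct cov X₁ X₂ v.proj ∧
      ∀ᶠ t in 𝓝 (0 : ℝ), ∀ q : TangentBundle 𝓘(ℝ, E) M,
        q = ⟨v.proj, constField v.proj (fibreCoord v.proj v + t • (G t - G 0)) v.proj⟩ →
        upsilonFlow cov X₁ X₂ v t = Part.some q ∧
        upsilonTransport cov X₁ X₂ η₁ η₂ v t = Part.some q := by
  obtain ⟨ε₁, P₁, Q₁, h₁⟩ := exists_isParallelFrame cov hcov hX₁ hη₁
  obtain ⟨ε₂, P₂, Q₂, h₂⟩ := exists_isParallelFrame cov hcov hX₂ hη₂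
  rw [hη₁_zero] at h₁
  rw [hη₂_zero] at h₂
  have hn₁ : ∀ᶠ t in 𝓝 (0 : ℝ), t ∈ Ioo (-ε₁) ε₁ := Ioo_mem_nhds (neg_lt_zero.2 h₁.pos) h₁.pos
  have hn₂ : ∀ᶠ t in 𝓝 (0 : ℝ), t ∈ Ioo (-ε₂) ε₂ := Ioo_mem_nhds (neg_lt_zero.2 h₂.pos) h₂.pos
  refine ⟨fun t ↦ Q₂ t (fibreCoord v.proj ⟨η₂ t, X₁ (η₂ t)⟩) +
      Q₁ t (fibreCoord v.proj ⟨η₁ t, X₂ (η₁ t)⟩),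
    fun t ↦ Q₂ t (fibreCoord v.proj ⟨η₂ t, cov X₁ (η₂ t) (X₂ (η₂ t))⟩) +
      Q₁ t (fibreCoord v.proj ⟨η₁ t, cov X₂ (η₁ t) (X₁ (η₁ t))⟩), ?_, ?_, ?_, ?_⟩
  · filter_upwards [hn₁, hn₂] with t ht₁ ht₂
    exact (h₂.hasDerivAt_inv_fibreCoord hX₁ ht₂).fun_add (h₁.hasDerivAt_inv_fibreCoord hX₂ ht₁)
  · exact (h₂.continuousAt_inv_fibreCoord hcov hX₂ hX₁).fun_add
      (h₁.continuousAt_inv_fibreCoord hcov hX₁ hX₂)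
  · -- At time `0` the operators are the identity, and so is the fibre coordinate over `v.proj`.
    dsimp only
    rw [h₁.inv_zero, h₂.inv_zero, hη₁_zero, hη₂_zero, fibreCoord_self, fibreCoord_self]
    exact add_comm _ _
  · filter_upwards [hn₁, hn₂] with t ht₁ ht₂ q hq
    have hv := constField_fibreCoord_total v
    have hsum : ∀ a b c d : E, fibreCoord v.proj v + t • (a - b) + t • (c - d) =
        fibreCoord v.proj v + t • ((a + c) - (b + d)) := fun a b c d ↦ by module
    constructor
    · have e₂ := h₂.flow_loop_eq hη₂_zero hX₂ X₁ ht₂ (fibreCoord v.proj v)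
      rw [hv] at e₂
      unfold upsilonFlow
      rw [e₂, some_bind_pfun, h₁.flow_loop_eq hη₁_zero hX₁ X₂ ht₁, hsum, hq]
    · have e₂ := h₂.transport_loop_eq hη₂_zero X₁ ht₂ (fibreCoord v.proj v)
      rw [hv] at e₂
      unfold upsilonTransport
      rw [e₂, some_bind_pfun, h₁.transport_loop_eq hη₁_zero X₂ ht₁, hsum, hq]

end Loops

end

theorem theorem3p2
    {E : Type*} [NormedAddCommGroup E] [NormedSpace ℝ E] [FiniteDimensional ℝ E]
    {M : Type*} [TopologicalSpace M] [T2Space M] [ChartedSpace E M] [IsManifold 𝓘(ℝ, E) ∞ M]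
    (cov : CovariantDerivative 𝓘(ℝ, E) E (TangentSpace 𝓘(ℝ, E) : M → Type _))
    (hcov : CovariantDerivative.ContMDiffCovariantDerivative cov ∞)
    (X₁ X₂ : (x : M) → TangentSpace 𝓘(ℝ, E) x)
    (hX₁ : ContMDiff 𝓘(ℝ, E) 𝓘(ℝ, E).tangent ∞
      (fun x ↦ (⟨x, X₁ x⟩ : TangentBundle 𝓘(ℝ, E) M)))
    (hX₂ : ContMDiff 𝓘(ℝ, E) 𝓘(ℝ, E).tangent ∞
      (fun x ↦ (⟨x, X₂ x⟩ : TangentBundle 𝓘(ℝ, E) M)))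
    (v : TangentBundle 𝓘(ℝ, E) M)
    (η₁ η₂ : ℝ → M)
    (hη₁ : IsMIntegralCurveAt η₁ X₁ 0) (hη₁_zero : η₁ 0 = v.proj)
    (hη₂ : IsMIntegralCurveAt η₂ X₂ 0) (hη₂_zero : η₂ 0 = v.proj)
    (Υ : ℝ →. TangentBundle 𝓘(ℝ, E) M)
    (hΥ : Υ = upsilonFlow cov X₁ X₂ v ∨
      Υ = upsilonFlow (torsionFreePart cov) X₁ X₂ v ∨
      Υ = upsilonTransport cov X₁ X₂ η₁ η₂ v ∨
      Υ = upsilonTransport (torsionFreePart cov) X₁ X₂ η₁ η₂ v) :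
    (∀ᶠ t in 𝓝 (0 : ℝ), (Υ t).Dom) ∧
    ∀ c : ℝ → TangentBundle 𝓘(ℝ, E) M, (∀ᶠ t in 𝓝 (0 : ℝ), c t ∈ Υ t) →
      c 0 = v ∧
      HasMFDerivAt 𝓘(ℝ, ℝ) 𝓘(ℝ, E).tangent c 0 0 ∧
      ∃ a : TangentSpace 𝓘(ℝ, E).tangent (c 0),
        HasSecondMDerivAt 𝓘(ℝ, E).tangent c 0 a ∧
        (1 / 2 : ℝ) • a = verticalLift (symmetricProduct cov X₁ X₂) (c 0) := by
  have hsmooth : PreservesSmooth cov := preservesSmooth_of_contMDiff cov hcov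
  obtain ⟨G, G', hG, hG', hG'0, hΥG⟩ : ∃ G G' : ℝ → E,
      (∀ᶠ t in 𝓝 (0 : ℝ), HasDerivAt G (G' t) t) ∧ ContinuousAt G' 0 ∧
      G' 0 = symmetricProduct cov X₁ X₂ v.proj ∧
      ∀ᶠ t in 𝓝 (0 : ℝ), Υ t = Part.some ⟨v.proj,
        constField v.proj (fibreCoord v.proj v + t • (G t - G 0)) v.proj⟩ := by
    obtain ⟨G, G', h1, h2, h3, h4⟩ :=
      exists_eventually_upsilon_eq hsmooth hX₁ hX₂ v hη₁ hη₁_zero hη₂ hη₂_zero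
    obtain ⟨K, K', h1', h2', h3', h4'⟩ := exists_eventually_upsilon_eq
      (preservesSmooth_torsionFreePart cov hsmooth) hX₁ hX₂ v hη₁ hη₁_zero hη₂ hη₂_zero
    rw [symmetricProduct_torsionFreePart] at h3'
    rcases hΥ with rfl | rfl | rfl | rfl
    · exact ⟨G, G', h1, h2, h3, h4.mono fun t ht ↦ (ht _ rfl).1⟩
    · exact ⟨K, K', h1', h2', h3', h4'.mono fun t ht ↦ (ht _ rfl).1⟩
    · exact ⟨G, G', h1, h2, h3, h4.mono fun t ht ↦ (ht _ rfl).2⟩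
    · exact ⟨K, K', h1', h2', h3', h4'.mono fun t ht ↦ (ht _ rfl).2⟩
  refine ⟨hΥG.mono fun t ht ↦ by rw [ht]; trivial, fun c hc ↦ ?_⟩
  have hcG : c =ᶠ[𝓝 0] fun t ↦ ⟨v.proj,
      constField v.proj (fibreCoord v.proj v + t • (G t - G 0)) v.proj⟩ := by
    filter_upwards [hc, hΥG] with t h1 h2
    rw [h2] at h1
    exact Part.mem_some_iff.1 h1
  have hc0 : c 0 = v := by
    rw [hcG.self_of_nhds]
    simp only [zero_smul, add_zero]
    exact constField_fibreCoord_total v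
  rw [← hc0] at hcG hG'0
  have hsecond := hasSecondMDerivAt_of_eventuallyEq hG hG' hcG
  refine ⟨hc0, hsecond.1, _, hsecond, ?_⟩
  rw [smul_vlft]
  unfold verticalLift
  congr 1
  change (1 / 2 : ℝ) • ((2 : ℝ) • G' 0) = _
  rw [smul_smul, one_div_mul_cancel two_ne_zero, hG'0]
  exact one_smul ℝ _
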